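/- Conventions. All Banach spaces are real, complete, and of dimension at least $2$; a domain is a non-empty open connected set. For a domain $D\subsetneq E$ let $d_D(z)$ be the distance from $z\in D$ to $\partial D$, let $$j_D(x,y)=\log\Bigl(1+\frac{|x-y|}{\min\{d_D(x),d_D(y)\}}\Bigr),\qquad k_D(x,y)=\inf_\alpha\int_\alpha\frac{|dz|}{d_D(z)},$$ the infimum being over all rectifiable paths $\alpha$ from $x$ to $y$ in $D$. A growth function is a homeomorphism $\varphi:[0,\infty)\to[0,\infty)$ with $\varphi(t)\ge t$ for all $t$. For domains $D\subsetneq E$, $D'\subsetneq E'$, a homeomorphism $f:D\to D'$ is $M$-quasihyperbolic ($M$-QH) if $k_D(x,y)/M\le k_{D'}(f(x),f(y))\le M k_D(x,y)$ for all $x,y\in D$; it is $\varphi$-FQC (freely $\varphi$-quasiconformal), for a growth function $\varphi$, if for every domain $D_1\subset D$ and $D_1'=f(D_1)$ we have $k_{D_1'}(f(x),f(y))\le\varphi(k_{D_1}(x,y))$ and $k_{D_1}(x,y)\le\varphi(k_{D_1'}(f(x),f(y)))$ for all $x,y\in D_1$. For a self-homeomorphism $\varphi$ of $[0,\infty)$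 and a domain $D_1\subset D$ with $D_1'=f(D_1)$, consider the $j$-metric inequality $$\varphi^{-1}(j_{D_1}(x,y))\le j_{D_1'}(f(x),f(y))\le\varphi(j_{D_1}(x,y))\quad\text{for all }x,y\in D_1.\tag{$*$}$$ Theorem 1.3. Theorem 1.2 asserts that if there is a growth function $\varphi$ for which $(*)$ holds on every subdomain $D_1\subset D$, then $f$ is FQC, and that if $(*)$ holds for $D_1=D$ with $\varphi(t)=Mt$, $M\ge1$, then $f$ is $M_1$-QH for some $M_1$. Both converses fail: (a) It is not true that for all domains $D\subsetneq E$, $D'\subsetneq E'$ in Banach spaces and every homeomorphism $f:D\to D'$ that is $\varphi_1$-FQC for some growth function $\varphi_1$, there is a growth function $\varphi$ such that $(*)$ holds for every domain $D_1\subset D$. (b) It is not true that for all such $D,D'$ and every homeomorphism $f:D\to D'$ that is $M_1$-QH for some $M_1>1$, there is $M\ge1$ such that $(*)$ holds with $D_1=D$ and $\varphi(t)=Mt$. More precisely, the following are examples. (c) There is a conformal map of the unit disk $D=\mathbb B(0,1)\subset\mathbb C$ onto the slit disk $D'=\mathbb B(0,1)\setminus[0,1)$. There is a constant $M>1$ such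 that every such map $f$ is $M$-QH and $\varphi_1$-FQC with $\varphi_1(t)=Mt$. For every such $f$ and every self-homeomorphism $\varphi$ of $[0,\infty)$, $(*)$ fails for $D_1=D$ and also for $D_1=D\setminus\{f^{-1}(-\tfrac12)\}$. (d) Let $H$ be a real Hilbert space with an orthonormal basis $(e_j)_{j\in\mathbb Z}$, let $0<r\le\frac1{10}$, let $\gamma$ be the line spanned by $e_1$, $D=\gamma+\mathbb B(0,r)$, and let $\gamma'=\bigcup_{j\in\mathbb Z}[e_{j-1},e_j]$ be the infinite broken line. Call a homeomorphism locally $M$-bilipschitz ($M\ge 1$) if every point has a neighborhood in which $|y-z|/M\le|f(y)-f(z)|\le M|y-z|$ for all $y,z$. For some $M\ge1$ there is a locally $M$-bilipschitz homeomorphism $f$ of $D$ onto an open neighborhood $D'\subset\mathbb B(0,2)$ of $\gamma'$, with $f(\gamma)=\gamma'$. Moreover, for every $M\ge1$, every locally $M$-bilipschitz homeomorphism $f$ of $D$ onto a bounded open neighborhood $D'$ of $\gamma'$ is $M^2$-QH and $\varphi_1$-FQC with $\varphi_1(t)=M^2t$, while for no self-homeomorphism $\varphi$ of $[0,\infty)$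 does $(*)$ hold for $D_1=D$. -/

import Mathlib

open scoped NNReal Pointwise Topology

noncomputable section

namespace FreeQC

variable {E E' : Type*} [NormedAddCommGroup E] [NormedAddCommGroup E']

/-- A domain: a non-empty, open and connected set. -/
def IsDom (D : Set E) : Prop := IsOpen D ∧ IsConnected D

/-- The distance `d_D(z)` from `z` to the boundary of `D`. -/
def bdist (D : Set E) (z : E) : ℝ := Metric.infDist z (frontier D)

/-- The distance ratio metric `j_D`. -/
def jDist (D : Set E) (x y : E) : ℝ :=
  Real.log (1 + ‖x - y‖ / min (bdist D x) (bdist D y))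

/-- The rectifiable path of length `L` whose arc length parametrization is `γ : [0, L] → D`
joins `x` to `y` in `D`. -/
def JoinsIn (D : Set E) (x y : E) (L : ℝ) (γ : ℝ → E) : Prop :=
  0 ≤ L ∧ HasUnitSpeedOn γ (Set.Icc 0 L) ∧ (∀ t ∈ Set.Icc 0 L, γ t ∈ D) ∧ γ 0 = x ∧ γ L = y

/-- The quasihyperbolic length `∫ |dz| / d_D(z)` of a path of length `L` that is parametrized
by arc length. -/
def qhLength (D : Set E) (L : ℝ) (γ : ℝ → E) : ℝ := ∫ t in (0 : ℝ)..L, 1 / bdist D (γ t)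

/-- The quasihyperbolic distance `k_D(x, y)`: the infimum of the quasihyperbolic lengths of the
rectifiable paths from `x` to `y` in `D`. -/
def qhDist (D : Set E) (x y : E) : ℝ :=
  sInf {l : ℝ | ∃ (L : ℝ) (γ : ℝ → E), JoinsIn D x y L γ ∧ l = qhLength D L γ}

/-- A growth function: a self-homeomorphism `φ` of `[0, ∞)` with `φ(t) ≥ t`. -/
def IsGrowth (φ : ℝ≥0 ≃ₜ ℝ≥0) : Prop := ∀ t, t ≤ φ t

/-- `g : G → G'` is `φ`-semisolid. -/
def IsSemisolid (φ : ℝ≥0 ≃ₜ ℝ≥0) (g : E → E') (G : Set E) (G' : Set E') : Prop :=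
  ∀ x ∈ G, ∀ y ∈ G, qhDist G' (g x) (g y) ≤ φ (qhDist G x y).toNNReal

/-- `f` restricts to a `φ`-solid homeomorphism of `D₁` onto its image `f(D₁)`. -/
def IsSolidOn (φ : ℝ≥0 ≃ₜ ℝ≥0) (f : OpenPartialHomeomorph E E') (D₁ : Set E) : Prop :=
  IsSemisolid φ f D₁ (f '' D₁) ∧ IsSemisolid φ f.symm (f '' D₁) D₁

/-- The homeomorphism `f` of the open set `f.source` onto the open set `f.target` is freely
`φ`-quasiconformal: it is `φ`-solid on every (proper) subdomain. -/
def IsFQC (φ : ℝ≥0 ≃ₜ ℝ≥0) (f : OpenPartialHomeomorph E E') : Prop :=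
  ∀ D₁ : Set E, IsDom D₁ → D₁ ⊆ f.source → D₁ ≠ Set.univ → IsSolidOn φ f D₁

/-- `f` is an `M`-quasihyperbolic homeomorphism of `f.source` onto `f.target`. -/
def IsQH (M : ℝ) (f : OpenPartialHomeomorph E E') : Prop :=
  ∀ x ∈ f.source, ∀ y ∈ f.source,
    qhDist f.source x y / M ≤ qhDist f.target (f x) (f y) ∧
      qhDist f.target (f x) (f y) ≤ M * qhDist f.source x y

/-- The two-sided distance ratio inequality
`φ⁻¹(j_{D₁}(x, y)) ≤ j_{f(D₁)}(f(x), f(y)) ≤ φ(j_{D₁}(x, y))` for all `x, y ∈ D₁`. -/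
def JIneqOn (φ : ℝ≥0 ≃ₜ ℝ≥0) (f : OpenPartialHomeomorph E E') (D₁ : Set E) : Prop :=
  ∀ x ∈ D₁, ∀ y ∈ D₁,
    (φ.symm (jDist D₁ x y).toNNReal : ℝ) ≤ jDist (f '' D₁) (f x) (f y) ∧
      jDist (f '' D₁) (f x) (f y) ≤ φ (jDist D₁ x y).toNNReal

/-- The homeomorphism `f` of `f.source` onto `f.target` is locally `M`-bilipschitz. -/
def IsLocBilip (M : ℝ) (f : OpenPartialHomeomorph E E') : Prop :=
  ∀ x ∈ f.source, ∃ U ∈ 𝓝 x, U ⊆ f.source ∧ ∀ y ∈ U, ∀ z ∈ U,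
    ‖y - z‖ / M ≤ ‖f y - f z‖ ∧ ‖f y - f z‖ ≤ M * ‖y - z‖

/-- The slit disk `B(0,1) \ [0,1)` in the complex plane. -/
def slitDisk : Set ℂ := Metric.ball 0 1 \ ((fun t : ℝ => (t : ℂ)) '' Set.Ico 0 1)

/-- `f` is a conformal mapping of the unit disk onto the slit disk. -/
def IsSlitMap (f : OpenPartialHomeomorph ℂ ℂ) : Prop :=
  f.source = Metric.ball 0 1 ∧ f.target = slitDisk ∧ DifferentiableOn ℂ f f.source

section Hilbert

variable {H : Type*} [NormedAddCommGroup H] [InnerProductSpace ℝ H]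

/-- The line spanned by `e₁`. -/
def axis (e : HilbertBasis ℤ ℝ H) : Set H := Set.range fun t : ℝ => t • e 1

/-- The tube of radius `r` about the line spanned by `e₁`. -/
def tube (e : HilbertBasis ℤ ℝ H) (r : ℝ) : Set H := axis e + Metric.ball 0 r

/-- The infinite broken line, the union of the segments `[e_{j-1}, e_j]` for `j ∈ ℤ`. -/
def brokenLine (e : HilbertBasis ℤ ℝ H) : Set H := ⋃ j : ℤ, segment ℝ (e (j - 1)) (e j)

end Hilbert

end FreeQC

end

/-! Positive half. Everything rests on `qhDist_le_mul_of_eventually`: if near each `x` the map `g`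
stretches by at most any `K > M * d'(g x) / d(x)`, then `g` increases quasihyperbolic distance at
most by the factor `M`; one integrates along paths. By `isFQC_and_isQH_of_eventually`, such a bound
for `f` and its inverse on all subdomains makes `f` both FQC and QH with the linear function `M t`.
So it suffices to bound `d'(f x)` from below. For a conformal map this is a Koebe type theorem,
`ball_subset_image_ball`: `|f'(x)| d(x) ≤ 32 d'(f x)`. For a locally `M`-bilipschitz homeomorphism,
lifting segments gives `d(x) ≤ M d'(f x)` (`IsLocBilip.ball_subset_image_ball`), and the factor is
`M²`.

Negative half. The inequality `(*)` keeps `j` bounded on pairs whose images have bounded `j`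
(`JIneqOn.exists_jDist_le`). Slit disk: the points `1/2 ± iε` on the two sides of the slit have `j ≤
log 3` in the image. A path between them must go round the tip of the slit, so their quasihyperbolic
distance tends to infinity as `ε → 0`. By the QH property the same is true of the preimages in the
disk. The disk is convex, so there `k ≤ exp j - 1`, and the `j`-distance of the preimages is
unbounded. Tube: points far apart on the axis have large `j`, while their images lie in a bounded
set at distance at least `r / M` from its boundary.

Existence. The slit map is an explicit composition of Möbius maps, a square root and a square. The
tube is bent along the broken line by `bend`: isometric frames `T n` are attached to the vertices so
that consecutive ones differ by a quarter turn, and are interpolated linearly in between. The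
interpolated frame stays normal to the interpolated direction, is bounded below, and fills the
normal hyperplane. This gives bilipschitz bounds and, through the intermediate value theorem in one
real variable, openness of the image in infinite dimension. -/

noncomputable section

namespace FreeQC

/-! ### Boundary distance, unit speed paths and quasihyperbolic length. -/

section Metric

variable {E : Type*} [NormedAddCommGroup E] {D : Set E}

open Metric Set

lemma bdist_le_add (D : Set E) (x y : E) : bdist D x ≤ bdist D y + dist x y :=
  infDist_le_infDist_add_dist

lemma continuous_bdist (D : Set E) : Continuous (bdist D) := continuous_infDist_pt _

lemma bdist_nonneg (D : Set E) (x : E) : 0 ≤ bdist D x := infDist_nonneg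

lemma _root_.HasUnitSpeedOn.dist_le {γ : ℝ → E} {s : Set ℝ} (h : HasUnitSpeedOn γ s) {x y : ℝ}
    (hx : x ∈ s) (hy : y ∈ s) : dist (γ x) (γ y) ≤ |x - y| := by
  wlog hxy : x ≤ y generalizing x y
  · rw [dist_comm, abs_sub_comm]
    exact this hy hx (le_of_not_ge hxy)
  have h1 := eVariationOn.edist_le γ (s := s ∩ Icc x y) (x := x) (y := y)
    ⟨hx, le_rfl, hxy⟩ ⟨hy, hxy, le_rfl⟩
  rw [h hx hy, edist_dist] at h1
  simp only [NNReal.coe_one, one_mul] at h1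
  rw [ENNReal.ofReal_le_ofReal_iff (by linarith)] at h1
  rw [abs_sub_comm, abs_of_nonneg (by linarith)]
  exact h1

lemma _root_.HasUnitSpeedOn.continuousOn {γ : ℝ → E} {s : Set ℝ} (h : HasUnitSpeedOn γ s) :
    ContinuousOn γ s := by
  have : LipschitzOnWith 1 γ s := LipschitzOnWith.of_dist_le_mul fun x hx y hy => by
    simpa [Real.dist_eq] using h.dist_le hx hy
  exact this.continuousOn

/-- The variation of an isometric path is at most the parameter length because the path is
1-Lipschitz, and at least the distance of the endpoints. -/
lemma hasUnitSpeedOn_of_dist_eq {γ : ℝ → E} {s : Set ℝ}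
    (h : ∀ x ∈ s, ∀ y ∈ s, dist (γ x) (γ y) = |x - y|) : HasUnitSpeedOn γ s := by
  intro x hx y hy
  simp only [NNReal.coe_one, one_mul]
  rcases le_or_gt x y with hxy | hxy
  · apply le_antisymm
    · have hL : LipschitzOnWith 1 γ (s ∩ Icc x y) := LipschitzOnWith.of_dist_le_mul
        fun a ha b hb => by simp [Real.dist_eq, h a ha.1 b hb.1]
      have h1 := hL.comp_eVariationOn_le (g := (id : ℝ → ℝ)) (s := s ∩ Icc x y)
        (fun a ha => ha)
      have h2 := ((monotone_id.monotoneOn s).eVariationOn_eq hx hy).le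
      simpa using h1.trans (by simpa using h2)
    · rw [show ENNReal.ofReal (y - x) = edist (γ x) (γ y) by
        rw [edist_dist, h x hx y hy, abs_sub_comm, abs_of_nonneg (by linarith)]]
      exact eVariationOn.edist_le γ ⟨hx, le_rfl, hxy⟩ ⟨hy, hxy, le_rfl⟩
  · rw [Icc_eq_empty (by linarith), inter_empty, ENNReal.ofReal_of_nonpos (by linarith)]
    exact eVariationOn.subsingleton _ (by simp)

lemma JoinsIn.le_length {x y : E} {L : ℝ} {γ : ℝ → E} (h : JoinsIn D x y L γ) {t : ℝ}
    (ht : t ∈ Icc 0 L) : dist x (γ t) ≤ t := by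
  have := h.2.1.dist_le (left_mem_Icc.2 h.1) ht
  rw [h.2.2.2.1] at this
  simpa [abs_of_nonneg ht.1] using this

lemma qhLength_nonneg {L : ℝ} (hL : 0 ≤ L) (γ : ℝ → E) : 0 ≤ qhLength D L γ :=
  intervalIntegral.integral_nonneg hL fun _ _ => one_div_nonneg.2 (bdist_nonneg _ _)

lemma bddBelow_qhLengths (D : Set E) (x y : E) :
    BddBelow {l : ℝ | ∃ (L : ℝ) (γ : ℝ → E), JoinsIn D x y L γ ∧ l = qhLength D L γ} :=
  ⟨0, by rintro _ ⟨L, γ, h, rfl⟩; exact qhLength_nonneg h.1 γ⟩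

lemma qhDist_le_qhLength {x y : E} {L : ℝ} {γ : ℝ → E} (h : JoinsIn D x y L γ) :
    qhDist D x y ≤ qhLength D L γ :=
  csInf_le (bddBelow_qhLengths D x y) ⟨L, γ, h, rfl⟩

lemma qhDist_nonneg (D : Set E) (x y : E) : 0 ≤ qhDist D x y :=
  Real.sInf_nonneg (by rintro _ ⟨L, γ, h, rfl⟩; exact qhLength_nonneg h.1 γ)

end Metric

/-! ### Elementary estimates of the quasihyperbolic metric. -/

section Basics

variable {E : Type*} [NormedAddCommGroup E] [NormedSpace ℝ E] {D : Set E}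

open Metric Set

lemma frontier_nonempty_of_isOpen (hD : D.Nonempty) (hne : D ≠ univ) : (frontier D).Nonempty :=
  nonempty_frontier_iff.2 ⟨hD, hne⟩

/-- The whole space is excluded here and below since its frontier is empty, where `infDist` takes
the value `0`. -/
lemma le_bdist (hD : IsOpen D) (hne : D ≠ univ) {z : E} {r : ℝ} (hz : z ∈ D)
    (h : ball z r ⊆ D) : r ≤ bdist D z := by
  refine (le_infDist (frontier_nonempty_of_isOpen ⟨z, hz⟩ hne)).2 fun w hw => ?_
  by_contra hlt
  have : w ∈ D := h (by rw [mem_ball, dist_comm]; exact not_le.1 hlt)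
  exact (hD.inter_frontier_eq ▸ (⟨this, hw⟩ : w ∈ D ∩ frontier D) : w ∈ (∅ : Set E))

/-- A segment leaving `D` crosses the frontier, so points outside `D` are no closer than the
boundary. -/
lemma bdist_le_dist (hD : IsOpen D) {z w : E} (hz : z ∈ D) (hw : w ∉ D) :
    bdist D z ≤ dist z w := by
  have hseg : IsPreconnected (segment ℝ z w) := (convex_segment z w).isPreconnected
  obtain ⟨p, hp, hpf⟩ : ∃ p ∈ segment ℝ z w, p ∈ frontier D := by
    by_contra hcon
    push Not at hcon
    have hsub : segment ℝ z w ⊆ D ∪ (closure D)ᶜ := fun p hp => by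
      by_cases hpc : p ∈ closure D
      · left
        by_contra hpD
        exact hcon p hp ⟨hpc, by rwa [hD.interior_eq]⟩
      · exact Or.inr hpc
    have := hseg.subset_left_of_subset_union hD isClosed_closure.isOpen_compl
      (disjoint_compl_right_iff_subset.2 subset_closure) hsub
      ⟨z, left_mem_segment ℝ z w, hz⟩
    exact hw (this (right_mem_segment ℝ z w))
  refine (infDist_le_dist_of_mem hpf).trans ?_
  have := dist_add_dist_of_mem_segment hp
  linarith [dist_nonneg (x := p) (y := w)]

lemma ball_bdist_subset (hD : IsOpen D) {z : E} (hz : z ∈ D) : ball z (bdist D z) ⊆ D := by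
  intro w hw
  by_contra h
  have := bdist_le_dist hD hz h
  rw [mem_ball, dist_comm] at hw
  linarith

lemma bdist_pos (hD : IsOpen D) (hne : D ≠ univ) {z : E} (hz : z ∈ D) : 0 < bdist D z := by
  obtain ⟨r, hr, h⟩ := Metric.isOpen_iff.1 hD z hz
  exact hr.trans_le (le_bdist hD hne hz h)

lemma joinsIn_segment {x y : E} (h : segment ℝ x y ⊆ D) :
    ∃ γ : ℝ → E, JoinsIn D x y ‖y - x‖ γ ∧ ∀ t ∈ Icc 0 ‖y - x‖, γ t ∈ segment ℝ x y := by
  rcases eq_or_ne x y with rfl | hxy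
  · refine ⟨fun _ => x, ⟨norm_nonneg _, ?_, ?_, rfl, rfl⟩, fun t _ => left_mem_segment ℝ x x⟩
    · rw [sub_self, norm_zero, Icc_self]
      exact hasConstantSpeedOnWith_of_subsingleton _ subsingleton_singleton _
    · exact fun t _ => h (left_mem_segment ℝ x x)
  · have hn : 0 < ‖y - x‖ := norm_pos_iff.2 (sub_ne_zero.2 hxy.symm)
    have hmem : ∀ t ∈ Icc 0 ‖y - x‖, x + (t / ‖y - x‖) • (y - x) ∈ segment ℝ x y := by
      intro t ht
      rw [segment_eq_image']
      exact ⟨_, ⟨div_nonneg ht.1 hn.le, (div_le_one hn).2 ht.2⟩, rfl⟩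
    refine ⟨fun t => x + (t / ‖y - x‖) • (y - x), ⟨hn.le, ?_, fun t ht => h (hmem t ht), ?_, ?_⟩,
      hmem⟩
    · refine hasUnitSpeedOn_of_dist_eq fun s _ t _ => ?_
      rw [dist_eq_norm, add_sub_add_left_eq_sub, ← sub_smul, norm_smul, ← sub_div, norm_div,
        norm_norm, div_mul_cancel₀ _ hn.ne', Real.norm_eq_abs]
    · simp
    · simp [div_self hn.ne']

lemma JoinsIn.qhLength_continuousOn {x y : E} {L : ℝ} {γ : ℝ → E} (hD : IsOpen D)
    (hne : D ≠ univ) (h : JoinsIn D x y L γ) :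
    ContinuousOn (fun t => 1 / bdist D (γ t)) (Icc 0 L) :=
  continuousOn_const.div ((continuous_bdist D).comp_continuousOn h.2.1.continuousOn)
    fun t ht => (bdist_pos hD hne (h.2.2.1 t ht)).ne'

lemma JoinsIn.trans (hD : IsOpen D) (hne : D ≠ univ) {x y z : E} {L₁ L₂ : ℝ} {γ₁ γ₂ : ℝ → E}
    (h₁ : JoinsIn D x y L₁ γ₁) (h₂ : JoinsIn D y z L₂ γ₂) :
    ∃ γ, JoinsIn D x z (L₁ + L₂) γ ∧
      qhLength D (L₁ + L₂) γ = qhLength D L₁ γ₁ + qhLength D L₂ γ₂ := by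
  set γ : ℝ → E := fun t => if t ≤ L₁ then γ₁ t else γ₂ (t - L₁) with hγ
  have e₁ : EqOn γ γ₁ (Icc 0 L₁) := fun t ht => by simp [hγ, ht.2]
  have e₂ : EqOn γ (γ₂ ∘ fun t => t - L₁) (Icc L₁ (L₁ + L₂)) := fun t ht => by
    rcases eq_or_lt_of_le ht.1 with rfl | hlt
    · simp [hγ, h₁.2.2.2.2, h₂.2.2.2.1]
    · simp [hγ, hlt.not_ge]
  have hL₁ := h₁.1
  have hL₂ := h₂.1
  have u₁ : HasUnitSpeedOn γ (Icc 0 L₁) := fun a ha b hb => by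
    rw [eVariationOn.congr (e₁.mono inter_subset_left)]
    exact h₁.2.1 ha hb
  have u₂ : HasUnitSpeedOn γ (Icc L₁ (L₁ + L₂)) := fun a ha b hb => by
    rw [eVariationOn.congr (e₂.mono inter_subset_left),
      eVariationOn.comp_eq_of_monotoneOn _ _ (fun s _ t _ hst => by simpa using hst)]
    have himg : (fun t => t - L₁) '' (Icc L₁ (L₁ + L₂) ∩ Icc a b)
        = Icc 0 L₂ ∩ Icc (a - L₁) (b - L₁) := by
      rw [Set.image_inter (sub_left_injective), Set.image_sub_const_Icc, Set.image_sub_const_Icc]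
      simp
    rw [himg, h₂.2.1 ⟨by linarith [ha.1], by linarith [ha.2]⟩ ⟨by linarith [hb.1], by linarith [hb.2]⟩]
    congr 2
    ring
  have hJ : JoinsIn D x z (L₁ + L₂) γ := by
    refine ⟨by linarith, u₁.Icc_Icc u₂, fun t ht => ?_, ?_, ?_⟩
    · rcases le_total t L₁ with h | h
      · rw [e₁ ⟨ht.1, h⟩]; exact h₁.2.2.1 t ⟨ht.1, h⟩
      · rw [e₂ ⟨h, ht.2⟩]; exact h₂.2.2.1 _ ⟨by linarith, by linarith [ht.2]⟩
    · rw [e₁ ⟨le_rfl, hL₁⟩]; exact h₁.2.2.2.1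
    · rw [e₂ ⟨by linarith, le_rfl⟩]; simpa using h₂.2.2.2.2
  refine ⟨γ, hJ, ?_⟩
  have hc := hJ.qhLength_continuousOn hD hne
  have i₁ : IntervalIntegrable (fun t => 1 / bdist D (γ t)) MeasureTheory.volume 0 L₁ :=
    (hc.mono (by rw [uIcc_of_le hL₁]; exact Icc_subset_Icc_right (by linarith))).intervalIntegrable
  have i₂ : IntervalIntegrable (fun t => 1 / bdist D (γ t)) MeasureTheory.volume L₁ (L₁ + L₂) :=
    (hc.mono (by rw [uIcc_of_le (by linarith)]; exact Icc_subset_Icc_left hL₁)).intervalIntegrable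
  rw [qhLength, ← intervalIntegral.integral_add_adjacent_intervals i₁ i₂]
  congr 1
  · refine intervalIntegral.integral_congr fun t ht => ?_
    rw [uIcc_of_le hL₁] at ht
    simp only [e₁ ht]
  · have : ∫ t in L₁..(L₁ + L₂), 1 / bdist D (γ t)
        = ∫ t in L₁..(L₁ + L₂), (fun s => 1 / bdist D (γ₂ s)) (t - L₁) := by
      refine intervalIntegral.integral_congr fun t ht => ?_
      rw [uIcc_of_le (by linarith)] at ht
      simp only [e₂ ht, Function.comp]
    rw [this, intervalIntegral.integral_comp_sub_right (fun s => 1 / bdist D (γ₂ s)) L₁]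
    simp [qhLength]

/-- Being joined is transitive, and holds in both directions for nearby points because of segments
in balls; connectedness does the rest. -/
lemma exists_joinsIn (hD : IsDom D) (hne : D ≠ univ) {x y : E} (hx : x ∈ D) (hy : y ∈ D) :
    ∃ L γ, JoinsIn D x y L γ := by
  refine hD.2.isPreconnected.induction₂' (fun x y => ∃ L γ, JoinsIn D x y L γ) (fun x hx => ?_)
    (fun x y z _ _ _ ⟨L₁, γ₁, h₁⟩ ⟨L₂, γ₂, h₂⟩ => ?_) hx hy
  · obtain ⟨r, hr, h⟩ := Metric.isOpen_iff.1 hD.1 x hx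
    filter_upwards [mem_nhdsWithin_of_mem_nhds (ball_mem_nhds x hr)] with y hy
    have hs : segment ℝ x y ⊆ D :=
      ((convex_ball x r).segment_subset (mem_ball_self hr) hy).trans h
    obtain ⟨γ, hγ, -⟩ := joinsIn_segment hs
    obtain ⟨γ', hγ', -⟩ := joinsIn_segment (segment_symm ℝ x y ▸ hs)
    exact ⟨⟨_, γ, hγ⟩, ⟨_, γ', hγ'⟩⟩
  · obtain ⟨γ, h, -⟩ := h₁.trans hD.1 hne h₂
    exact ⟨_, γ, h⟩

/-- The infimum of an empty set of reals is `0`, so a lower bound needs the existence of at least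
one path. -/
lemma le_qhDist (hD : IsDom D) (hne : D ≠ univ) {x y : E} (hx : x ∈ D) (hy : y ∈ D) {c : ℝ}
    (h : ∀ L γ, JoinsIn D x y L γ → c ≤ qhLength D L γ) : c ≤ qhDist D x y := by
  obtain ⟨L, γ, hγ⟩ := exists_joinsIn hD hne hx hy
  refine le_csInf ⟨_, L, γ, hγ, rfl⟩ ?_
  rintro _ ⟨L, γ, h', rfl⟩
  exact h L γ h'

lemma qhDist_triangle (hD : IsDom D) (hne : D ≠ univ) {x y z : E} (hx : x ∈ D) (hy : y ∈ D)
    (hz : z ∈ D) : qhDist D x z ≤ qhDist D x y + qhDist D y z := by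
  rw [← sub_le_iff_le_add]
  refine le_qhDist hD hne hx hy fun L₁ γ₁ h₁ => ?_
  rw [sub_le_comm]
  refine le_qhDist hD hne hy hz fun L₂ γ₂ h₂ => ?_
  obtain ⟨γ, h, e⟩ := h₁.trans hD.1 hne h₂
  linarith [qhDist_le_qhLength h]

lemma qhDist_le_of_segment (hD : IsOpen D) (hne : D ≠ univ) {x y : E} {m : ℝ} (hm : 0 < m)
    (h : segment ℝ x y ⊆ D) (hd : ∀ z ∈ segment ℝ x y, m ≤ bdist D z) :
    qhDist D x y ≤ ‖x - y‖ / m := by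
  obtain ⟨γ, hγ, hs⟩ := joinsIn_segment h
  refine (qhDist_le_qhLength hγ).trans ?_
  have hc := hγ.qhLength_continuousOn hD hne
  have := intervalIntegral.integral_mono_on (μ := MeasureTheory.volume) (g := fun _ => 1 / m) hγ.1
    (by rw [← uIcc_of_le hγ.1] at hc; exact hc.intervalIntegrable) intervalIntegrable_const
    fun t ht => one_div_le_one_div_of_le hm (hd _ (hs t ht))
  rw [qhLength]
  refine this.trans_eq ?_
  simp [norm_sub_rev, div_eq_mul_inv]

lemma qhDist_le_of_near (hD : IsOpen D) (hne : D ≠ univ) {x y : E} (hx : x ∈ D)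
    (hxy : ‖x - y‖ < bdist D x) : qhDist D x y ≤ ‖x - y‖ / (bdist D x - ‖x - y‖) := by
  have hle : ∀ z ∈ segment ℝ x y, dist x z ≤ ‖x - y‖ := fun z hz => by
    have := dist_add_dist_of_mem_segment hz
    rw [dist_eq_norm x y] at this
    linarith [dist_nonneg (x := z) (y := y)]
  refine qhDist_le_of_segment hD hne (by linarith) (fun z hz => ?_) fun z hz => ?_
  · refine ball_bdist_subset hD hx ?_
    rw [mem_ball, dist_comm]
    exact (hle z hz).trans_lt hxy
  · have := bdist_le_add D x z
    linarith [hle z hz]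

/-- A path that starts at `x` and reaches distance `ρ` from it is quasihyperbolically long. -/
lemma JoinsIn.log_le_qhLength (hD : IsOpen D) (hne : D ≠ univ) {x y : E} (hx : x ∈ D) {L : ℝ}
    {γ : ℝ → E} (h : JoinsIn D x y L γ) {t ρ : ℝ} (ht : t ∈ Icc 0 L) (hρ : ρ ≤ dist x (γ t))
    (hρ0 : 0 ≤ ρ) : Real.log (1 + ρ / bdist D x) ≤ qhLength D L γ := by
  have hd := bdist_pos hD hne hx
  set d := bdist D x
  have hρL : ρ ≤ L := hρ.trans ((h.le_length ht).trans ht.2)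
  have hc := h.qhLength_continuousOn hD hne
  have h1 : ∫ t in (0 : ℝ)..ρ, 1 / (d + t) = Real.log (1 + ρ / d) := by
    have := intervalIntegral.integral_comp_add_left (fun u : ℝ => 1 / u) d (a := 0) (b := ρ)
    rw [this, integral_one_div_of_pos (by linarith) (by linarith)]
    congr 1
    field_simp
    ring
  have i₁ : IntervalIntegrable (fun t => 1 / bdist D (γ t)) MeasureTheory.volume 0 ρ :=
    (hc.mono (by rw [uIcc_of_le hρ0]; exact Icc_subset_Icc_right hρL)).intervalIntegrable
  have i₂ : IntervalIntegrable (fun t => 1 / bdist D (γ t)) MeasureTheory.volume ρ L :=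
    (hc.mono (by rw [uIcc_of_le hρL]; exact Icc_subset_Icc_left hρ0)).intervalIntegrable
  rw [qhLength, ← intervalIntegral.integral_add_adjacent_intervals i₁ i₂, ← h1]
  have h2 : 0 ≤ ∫ t in ρ..L, 1 / bdist D (γ t) :=
    intervalIntegral.integral_nonneg hρL fun _ _ => one_div_nonneg.2 (bdist_nonneg _ _)
  -- After arc length `s` the path is within `s` of `x`, hence within `d + s` of the boundary.
  have h3 : ∫ t in (0 : ℝ)..ρ, 1 / (d + t) ≤ ∫ t in (0 : ℝ)..ρ, 1 / bdist D (γ t) := by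
    refine intervalIntegral.integral_mono_on hρ0 ?_ i₁ fun s hs => ?_
    · refine ContinuousOn.intervalIntegrable ?_
      rw [uIcc_of_le hρ0]
      exact continuousOn_const.div (by fun_prop) fun s hs => by linarith [hs.1]
    · have hsL : s ∈ Icc 0 L := ⟨hs.1, hs.2.trans hρL⟩
      refine one_div_le_one_div_of_le (bdist_pos hD hne (h.2.2.1 s hsL)) ?_
      have := bdist_le_add D (γ s) x
      rw [dist_comm] at this
      linarith [h.le_length hsL]
  linarith

end Basics

lemma isDom_image {E E' : Type*} [NormedAddCommGroup E] [NormedAddCommGroup E']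
    {f : OpenPartialHomeomorph E E'} {D₁ : Set E} (hD₁ : IsDom D₁)
    (hs : D₁ ⊆ f.source) : IsDom (f '' D₁) :=
  ⟨f.isOpen_image_of_subset_source hD₁.1 hs, hD₁.2.image _ (f.continuousOn.mono hs)⟩

/-! ### From infinitesimal to global quasihyperbolic distortion. -/

section Transfer

open Metric Set Filter

variable {E : Type*} [NormedAddCommGroup E] [NormedSpace ℝ E] {D : Set E}
variable {E' : Type*} [NormedAddCommGroup E'] [NormedSpace ℝ E'] {D' : Set E'}

lemma continuousOn_qhDist (hD : IsDom D) (hne : D ≠ univ) {x : E} (hx : x ∈ D) :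
    ContinuousOn (qhDist D x) D := by
  intro p hp
  have hd := bdist_pos hD.1 hne hp
  refine ContinuousAt.continuousWithinAt ?_
  have hn : Tendsto (fun q => ‖p - q‖) (𝓝 p) (𝓝 0) := by
    have : Continuous fun q => ‖p - q‖ := by fun_prop
    simpa using this.tendsto p
  have hlim : Tendsto (fun q => ‖p - q‖ / (bdist D p - 2 * ‖p - q‖)) (𝓝 p) (𝓝 0) := by
    have := hn.div ((tendsto_const_nhds (x := bdist D p)).sub (hn.const_mul 2)) (by simpa using hd.ne')
    rw [zero_div] at this
    exact this
  rw [ContinuousAt, tendsto_iff_dist_tendsto_zero]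
  refine squeeze_zero' (Eventually.of_forall fun _ => dist_nonneg) ?_ hlim
  filter_upwards [hn.eventually (gt_mem_nhds (show 0 < bdist D p / 2 by linarith)),
    hD.1.mem_nhds hp] with q hq hqD
  have hpq := qhDist_le_of_near hD.1 hne hp (y := q) (by linarith [norm_nonneg (p - q)])
  have hdq := bdist_le_add D p q
  rw [dist_eq_norm] at hdq
  have hqp := qhDist_le_of_near hD.1 hne hqD (y := p) (by rw [norm_sub_rev]; linarith)
  rw [norm_sub_rev q p] at hqp
  have t1 := qhDist_triangle hD hne hx hp hqD
  have t2 := qhDist_triangle hD hne hx hqD hp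
  have e1 : ‖p - q‖ / (bdist D p - ‖p - q‖) ≤ ‖p - q‖ / (bdist D p - 2 * ‖p - q‖) :=
    div_le_div_of_nonneg_left (norm_nonneg _) (by linarith) (by linarith [norm_nonneg (p - q)])
  have e2 : ‖p - q‖ / (bdist D q - ‖p - q‖) ≤ ‖p - q‖ / (bdist D p - 2 * ‖p - q‖) :=
    div_le_div_of_nonneg_left (norm_nonneg _) (by linarith) (by linarith)
  rw [Real.dist_eq, abs_le]
  constructor <;> linarith

/-- An infinitesimal bound on the quasihyperbolic distortion integrates to a global one. -/
theorem qhDist_le_mul_of_eventually (hD : IsDom D) (hne : D ≠ univ) (hD' : IsDom D')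
    (hne' : D' ≠ univ) {g : E → E'} (hmap : MapsTo g D D') {M : ℝ} (hM : 0 < M)
    (hloc : ∀ x ∈ D, ∀ K, M * bdist D' (g x) / bdist D x < K →
      ∀ᶠ y in 𝓝 x, ‖g y - g x‖ ≤ K * ‖y - x‖)
    {x y : E} (hx : x ∈ D) (hy : y ∈ D) : qhDist D' (g x) (g y) ≤ M * qhDist D x y := by
  rw [← div_le_iff₀' hM]
  refine le_qhDist hD hne hx hy fun L γ hγ => ?_
  rw [div_le_iff₀' hM]
  have hL := hγ.1
  have hgc : ContinuousOn g D := by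
    intro p hp
    refine ContinuousAt.continuousWithinAt ?_
    obtain ⟨K, hK⟩ := exists_gt (M * bdist D' (g p) / bdist D p)
    rw [ContinuousAt, tendsto_iff_norm_sub_tendsto_zero]
    refine squeeze_zero' (Eventually.of_forall fun _ => norm_nonneg _) (hloc p hp K hK) ?_
    have : Continuous fun q => K * ‖q - p‖ := by fun_prop
    simpa using this.tendsto p
  have hcc : ContinuousOn (fun t => g (γ t)) (Icc 0 L) :=
    hgc.comp hγ.2.1.continuousOn hγ.2.2.1
  have hG : ContinuousOn (fun t => qhDist D' (g x) (g (γ t))) (Icc 0 L) :=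
    (continuousOn_qhDist hD' hne' (hmap hx)).comp hcc fun t ht => hmap (hγ.2.2.1 t ht)
  have hu := hγ.qhLength_continuousOn hD.1 hne
  -- The density is extended by constants to a continuous function on the line, so that its
  -- primitive is differentiable everywhere.
  set u : ℝ → ℝ := IccExtend hL ((Icc 0 L).domRestrict fun t => 1 / bdist D (γ t)) with hudef
  have huc : Continuous u := (continuousOn_iff_continuous_domRestrict.1 hu).Icc_extend'
  have hueq : ∀ t ∈ Icc 0 L, u t = 1 / bdist D (γ t) := fun t ht => by
    rw [hudef, IccExtend_of_mem hL _ ht]; rfl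
  have hB : ∀ t, HasDerivAt (fun t => M * ∫ s in (0 : ℝ)..t, u s) (M * u t) t := fun t =>
    (intervalIntegral.integral_hasDerivAt_right (huc.intervalIntegrable _ _)
      (huc.stronglyMeasurableAtFilter _ _) huc.continuousAt).const_mul M
  -- The function `t ↦ k'(g x, g (γ t))` is compared with `M` times the quasihyperbolic length of
  -- `γ` up to `t`; only its right slopes need to be bounded.
  have key := image_le_of_liminf_slope_right_le_deriv_boundary hG
    (B := fun t => M * ∫ s in (0 : ℝ)..t, u s) (B' := fun t => M * u t) ?_
    (fun t _ => (hB t).continuousAt.continuousWithinAt) (fun t _ => (hB t).hasDerivWithinAt) ?_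
    (right_mem_Icc.2 hL)
  · simp only [hγ.2.2.2.2] at key
    refine key.trans_eq ?_
    rw [qhLength]
    congr 1
    refine intervalIntegral.integral_congr fun t ht => hueq t ?_
    rwa [uIcc_of_le hL] at ht
  · have : qhDist D' (g x) (g (γ 0)) ≤ 0 := by
      rw [hγ.2.2.2.1]
      have := qhDist_le_of_near hD'.1 hne' (hmap hx) (y := g x)
        (by simpa using bdist_pos hD'.1 hne' (hmap hx))
      simpa using this
    simpa using this
  · intro t ht r hr
    have htI : t ∈ Icc 0 L := Ico_subset_Icc_self ht
    have hp := hγ.2.2.1 t htI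
    have hd := bdist_pos hD.1 hne hp
    have hd' := bdist_pos hD'.1 hne' (hmap hp)
    rw [hueq t htI] at hr
    set d' := bdist D' (g (γ t))
    -- The gap `K / r < d'` absorbs the loss in the denominator `d' - ‖g (γ t) - g (γ s)‖` of
    -- `qhDist_le_of_near`.
    obtain ⟨K, hK1, hK2⟩ := exists_between (show M * d' / bdist D (γ t) < r * d' by
      have := mul_lt_mul_of_pos_right hr hd'
      calc M * d' / bdist D (γ t) = M * (1 / bdist D (γ t)) * d' := by ring
        _ < _ := this)
    have hK0 : 0 < K := lt_of_le_of_lt (by positivity) hK1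
    have hr0 : 0 < r := lt_of_le_of_lt (by positivity) hr
    have hγt : Tendsto γ (𝓝[Ioi t] t) (𝓝 (γ t)) := by
      refine ((hγ.2.1.continuousOn t htI).mono_left ?_)
      rw [← nhdsWithin_Ioo_eq_nhdsGT ht.2]
      exact nhdsWithin_mono _ fun s hs => ⟨ht.1.trans hs.1.le, hs.2.le⟩
    have hsmall : ∀ᶠ s in 𝓝[>] t, K * (s - t) < d' - K / r := by
      have : Continuous fun s => K * (s - t) := by fun_prop
      refine ((this.tendsto t).mono_left nhdsWithin_le_nhds).eventually (gt_mem_nhds ?_)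
      rw [sub_self, mul_zero, sub_pos, div_lt_iff₀ hr0]
      linarith
    refine Eventually.frequently ?_
    filter_upwards [hγt.eventually (hloc _ hp K hK1), hsmall, Ioo_mem_nhdsGT ht.2] with s hs1 hs2 hs3
    have hst : 0 < s - t := sub_pos.2 hs3.1
    have hsI : s ∈ Icc 0 L := ⟨ht.1.trans hs3.1.le, hs3.2.le⟩
    have h1 : ‖g (γ t) - g (γ s)‖ ≤ K * (s - t) := by
      rw [norm_sub_rev]
      refine hs1.trans (mul_le_mul_of_nonneg_left ?_ hK0.le)
      have := hγ.2.1.dist_le hsI htI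
      rwa [dist_eq_norm, abs_of_pos hst] at this
    have hKr : 0 < K / r := div_pos hK0 hr0
    have h2 := qhDist_le_of_near hD'.1 hne' (hmap hp) (y := g (γ s)) (by linarith)
    have h3 : ‖g (γ t) - g (γ s)‖ / (d' - ‖g (γ t) - g (γ s)‖) < r * (s - t) := by
      rw [div_lt_iff₀ (by linarith)]
      have : K / r < d' - ‖g (γ t) - g (γ s)‖ := by linarith
      calc _ ≤ K * (s - t) := h1
        _ = r * (s - t) * (K / r) := by field_simp
        _ < _ := by gcongr
    have h4 := qhDist_triangle hD' hne' (hmap hx) (hmap hp) (hmap (hγ.2.2.1 s hsI))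
    rw [slope_def_field, div_lt_iff₀ hst]
    linarith

/-- Multiplication by a positive constant, as a self-homeomorphism of `[0, ∞)`. -/
def linearGrowth (M : ℝ) (hM : 1 ≤ M) : ℝ≥0 ≃ₜ ℝ≥0 :=
  Homeomorph.mulLeft₀ M.toNNReal (by simpa using lt_of_lt_of_le one_pos hM)

lemma linearGrowth_apply {M : ℝ} (hM : 1 ≤ M) (t : ℝ≥0) : (linearGrowth M hM t : ℝ) = M * t := by
  simp [linearGrowth, Real.coe_toNNReal M (zero_le_one.trans hM)]

lemma isGrowth_linearGrowth {M : ℝ} (hM : 1 ≤ M) : IsGrowth (linearGrowth M hM) := fun t => by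
  rw [← NNReal.coe_le_coe, linearGrowth_apply]
  nlinarith [t.coe_nonneg]

/-- If `f` and its inverse distort the quasihyperbolic metric of every subdomain infinitesimally
by at most `M`, then `f` is freely quasiconformal with a linear growth function. -/
theorem isFQC_and_isQH_of_eventually {f : OpenPartialHomeomorph E E'} {M : ℝ} (hM : 1 ≤ M)
    (hsrc : IsDom f.source) (hne : f.source ≠ univ) (hne' : f.target ≠ univ)
    (h : ∀ D₁ : Set E, IsDom D₁ → D₁ ⊆ f.source → ∀ x ∈ D₁,
      ∀ K, M * bdist (f '' D₁) (f x) / bdist D₁ x < K →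
        ∀ᶠ y in 𝓝 x, ‖f y - f x‖ ≤ K * ‖y - x‖)
    (h' : ∀ D₁ : Set E', IsDom D₁ → D₁ ⊆ f.target → ∀ x ∈ D₁,
      ∀ K, M * bdist (f.symm '' D₁) (f.symm x) / bdist D₁ x < K →
        ∀ᶠ y in 𝓝 x, ‖f.symm y - f.symm x‖ ≤ K * ‖y - x‖) :
    IsFQC (linearGrowth M hM) f ∧ IsQH M f := by
  have hM0 : 0 < M := by linarith
  have main : ∀ D₁ : Set E, IsDom D₁ → D₁ ⊆ f.source → D₁ ≠ univ →
      (∀ x ∈ D₁, ∀ y ∈ D₁, qhDist (f '' D₁) (f x) (f y) ≤ M * qhDist D₁ x y) ∧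
      (∀ x ∈ f '' D₁, ∀ y ∈ f '' D₁,
        qhDist D₁ (f.symm x) (f.symm y) ≤ M * qhDist (f '' D₁) x y) := by
    intro D₁ hD₁ hs hne₁
    have hI := isDom_image hD₁ hs
    have hIt : f '' D₁ ⊆ f.target := by
      rintro _ ⟨x, hx, rfl⟩; exact f.map_source (hs hx)
    have hIne : f '' D₁ ≠ univ := fun he => hne' (univ_subset_iff.1 (he ▸ hIt))
    have hinv : f.symm '' (f '' D₁) = D₁ := f.symm_image_image_of_subset_source hs
    refine ⟨fun x hx y hy => qhDist_le_mul_of_eventually hD₁ hne₁ hI hIne (mapsTo_image f D₁) hM0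
      (h D₁ hD₁ hs) hx hy, fun x hx y hy => ?_⟩
    refine qhDist_le_mul_of_eventually hI hIne hD₁ hne₁ ?_ hM0 ?_ hx hy
    · intro p hp
      rw [← hinv]; exact mem_image_of_mem _ hp
    · have := h' (f '' D₁) hI hIt
      rwa [hinv] at this
  have conv : ∀ a b : ℝ, 0 ≤ b → a ≤ M * b → a ≤ linearGrowth M hM b.toNNReal := by
    intro a b hb hab
    rwa [linearGrowth_apply, Real.coe_toNNReal _ hb]
  refine ⟨fun D₁ hD₁ hs hne₁ => ?_, fun x hx y hy => ?_⟩
  · obtain ⟨m1, m2⟩ := main D₁ hD₁ hs hne₁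
    exact ⟨fun x hx y hy => conv _ _ (qhDist_nonneg _ _ _) (m1 x hx y hy),
      fun x hx y hy => conv _ _ (qhDist_nonneg _ _ _) (m2 x hx y hy)⟩
  · obtain ⟨m1, m2⟩ := main f.source hsrc subset_rfl hne
    rw [f.image_source_eq_target] at m1 m2
    refine ⟨?_, m1 x hx y hy⟩
    have := m2 _ (f.map_source hx) _ (f.map_source hy)
    rw [f.left_inv hx, f.left_inv hy] at this
    rwa [div_le_iff₀' hM0]

end Transfer

/-! ### Koebe type distortion and conformal maps. -/

section Univalent

open Metric Set Filter

variable {f : OpenPartialHomeomorph ℂ ℂ}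

lemma isSimplyConnected_ball (z : ℂ) {R : ℝ} (hR : 0 < R) : IsSimplyConnected (ball z R) := by
  have : ContractibleSpace (ball z R) :=
    (convex_ball z R).contractibleSpace ⟨z, mem_ball_self hR⟩
  exact (inferInstance : SimplyConnectedSpace (ball z R))

/-- A continuous square root of a holomorphic function is holomorphic away from its zeros. -/
lemma hasDerivAt_of_sq_eq {g h : ℂ → ℂ} {z g' : ℂ} (hg : HasDerivAt g g' z)
    (hc : ContinuousAt h z) (hsq : ∀ᶠ ζ in 𝓝 z, h ζ ^ 2 = g ζ) (hz : h z ≠ 0) :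
    HasDerivAt h (g' / (2 * h z)) z := by
  rw [hasDerivAt_iff_tendsto_slope] at hg ⊢
  have hs : Tendsto (fun ζ => h ζ + h z) (𝓝[≠] z) (𝓝 (2 * h z)) := by
    rw [two_mul]
    exact (hc.tendsto.mono_left nhdsWithin_le_nhds).add_const _
  have h2 : (2 * h z) ≠ 0 := mul_ne_zero two_ne_zero hz
  refine (hg.div hs h2).congr' ?_
  filter_upwards [hs.eventually_ne h2, hsq.filter_mono nhdsWithin_le_nhds] with ζ h1 h3
  have h4 : h z ^ 2 = g z := hsq.self_of_nhds
  simp only [Pi.div_apply, slope_def_field]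
  rw [← h3, ← h4, sq_sub_sq, mul_div_assoc, mul_div_cancel_left₀ _ h1]

/-- A weak form of the Koebe one quarter theorem. -/
theorem ball_subset_image_ball (hf : DifferentiableOn ℂ f f.source) {z : ℂ} {R : ℝ} (hR : 0 < R)
    (hz : ball z R ⊆ f.source) : ball (f z) (‖deriv f z‖ * R / 32) ⊆ f '' ball z R := by
  intro w₀ hw₀
  by_contra hw₀'
  set V := f '' ball z R with hV
  have hVo : IsOpen V := f.isOpen_image_of_subset_source isOpen_ball hz
  have hzB : z ∈ ball z R := mem_ball_self hR
  have hzV : f z ∈ V := mem_image_of_mem f hzB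
  have hVne : V ≠ univ := fun h => hw₀' (h ▸ mem_univ _)
  have hdle : bdist V (f z) < ‖deriv f z‖ * R / 32 := by
    rw [mem_ball, dist_comm] at hw₀
    exact (bdist_le_dist hVo hzV hw₀').trans_lt hw₀
  have hdV := ball_bdist_subset hVo hzV
  -- The omitted point is replaced by a nearest boundary point, so that the ball of radius `‖f z -
  -- w‖` about `f z` lies in `V`.
  obtain ⟨w, hwf, hwd⟩ : ∃ w ∈ frontier V, bdist V (f z) = dist (f z) w :=
    isClosed_frontier.exists_infDist_eq_dist (frontier_nonempty_of_isOpen ⟨_, hzV⟩ hVne) _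
  have hwV : w ∉ V := fun h => by
    have : w ∈ V ∩ frontier V := ⟨h, hwf⟩
    rw [hVo.inter_frontier_eq] at this
    exact this
  obtain ⟨h, hc, hsq⟩ := Complex.exists_continuousOn_pow_eq (isSimplyConnected_ball z hR)
    isOpen_ball (g := fun ζ => f ζ - w) ((f.continuousOn.mono hz).sub continuousOn_const)
    (by rintro ⟨ζ, hζ, h0⟩; exact hwV ⟨ζ, hζ, sub_eq_zero.1 h0⟩) two_ne_zero
  have hne : ∀ ζ ∈ ball z R, h ζ ≠ 0 := fun ζ hζ h0 => hwV ⟨ζ, hζ, by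
    have := hsq ζ
    rw [h0] at this
    exact (sub_eq_zero.1 (by simpa using this.symm))⟩
  have hdf : ∀ ζ ∈ ball z R, HasDerivAt h (deriv f ζ / (2 * h ζ)) ζ := fun ζ hζ => by
    refine hasDerivAt_of_sq_eq (g := fun ζ => f ζ - w) ?_
      (hc.continuousAt (isOpen_ball.mem_nhds hζ)) (Eventually.of_forall hsq) (hne ζ hζ)
    exact ((hf.differentiableAt (f.open_source.mem_nhds (hz hζ))).hasDerivAt).sub_const w
  set b := h z with hb
  have hb0 : 0 < ‖b‖ := norm_pos_iff.2 (hne z hzB)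
  have hbd : ‖b‖ ^ 2 = bdist V (f z) := by
    rw [← norm_pow, hb, hsq z, hwd, dist_eq_norm]
  -- The root `h` of `f - w` covers this ball: for `‖u - b‖ < (2/5) ‖b‖` the point `u² + w` is in
  -- `V` because `(2/5)(2 + 2/5) = 24/25 < 1`, and `h (f.symm (u² + w))` is a continuous square root
  -- of `u²` that agrees with `u` at `b`.
  have hsurj : ∀ u ∈ ball b (2 / 5 * ‖b‖), ∃ ζ ∈ ball z R, h ζ = u := by
    have hmaps : ∀ u ∈ ball b (2 / 5 * ‖b‖), u ^ 2 + w ∈ V := fun u hu => by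
      refine hdV ?_
      rw [mem_ball, dist_eq_norm] at hu ⊢
      have h1 : u ^ 2 + w - f z = (u - b) * ((u - b) + 2 * b) := by
        have := hsq z
        rw [← hb] at this
        linear_combination this
      have h2 : ‖(u - b) + 2 * b‖ ≤ ‖u - b‖ + 2 * ‖b‖ := by
        refine (norm_add_le _ _).trans ?_
        simp
      rw [h1, norm_mul, ← hbd]
      nlinarith [norm_nonneg (u - b), norm_nonneg ((u - b) + 2 * b)]
    have hsymm : ∀ v ∈ V, f.symm v ∈ ball z R := by
      rintro _ ⟨ζ, hζ, rfl⟩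
      rwa [f.left_inv (hz hζ)]
    have hcφ : ContinuousOn (fun u : ℂ => h (f.symm (u ^ 2 + w))) (ball b (2 / 5 * ‖b‖)) := by
      refine hc.comp (f.continuousOn_symm.comp (by fun_prop) fun u hu => ?_)
        fun u hu => hsymm _ (hmaps u hu)
      obtain ⟨ζ, hζ, he⟩ := hmaps u hu
      rw [← he]
      exact f.map_source (hz hζ)
    have heq : EqOn (fun u : ℂ => h (f.symm (u ^ 2 + w))) (fun u => u) (ball b (2 / 5 * ‖b‖)) := by
      refine (convex_ball b _).isPreconnected.eq_of_sq_eq hcφ continuousOn_id (fun u hu => ?_)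
        (fun {u} hu h0 => ?_) (mem_ball_self (by positivity)) ?_
      · obtain ⟨ζ, hζ, he⟩ := hmaps u hu
        simp only [Pi.pow_apply]
        rw [hsq, f.right_inv, add_sub_cancel_right]
        rw [← he]
        exact f.map_source (hz hζ)
      · rw [mem_ball, dist_eq_norm] at hu
        rw [h0, zero_sub, norm_neg] at hu
        linarith
      · have : b ^ 2 + w = f z := by rw [hb, hsq z]; ring
        simp only [this]
        rw [f.left_inv (hz hzB)]
    exact fun u hu => ⟨_, hsymm _ (hmaps u hu), heq hu⟩
  -- By injectivity of `f` the map `h` never takes both a value and its negative, so it omits the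
  -- reflected ball about `-b`.
  have hfar : ∀ ζ ∈ ball z R, 2 / 5 * ‖b‖ ≤ ‖h ζ + b‖ := fun ζ hζ => by
    by_contra hlt
    obtain ⟨ζ', hζ', he⟩ := hsurj (-h ζ) (by
      rw [mem_ball, dist_eq_norm, ← norm_neg]
      simpa [add_comm] using not_le.1 hlt)
    have h1 : f ζ' = f ζ := by
      have e1 := hsq ζ
      have e2 := hsq ζ'
      rw [he] at e2
      linear_combination e1 - e2
    have h2 := f.injOn (hz hζ') (hz hζ) h1
    rw [h2] at he
    exact hne ζ hζ (by linear_combination he / 2)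
  have hfar0 : ∀ ζ ∈ ball z R, h ζ + b ≠ 0 := fun ζ hζ h0 => by
    have := hfar ζ hζ
    rw [h0, norm_zero] at this
    linarith
  have hinv : ∀ ζ ∈ ball z R, ‖(h ζ + b)⁻¹‖ ≤ 5 / 2 / ‖b‖ := fun ζ hζ => by
    rw [norm_inv, inv_le_comm₀ (norm_pos_iff.2 (hfar0 ζ hζ)) (by positivity)]
    refine le_trans (le_of_eq ?_) (hfar ζ hζ)
    field_simp
  have hF : ∀ ζ ∈ ball z R, HasDerivAt (fun ζ => (h ζ + b)⁻¹)
      (-(deriv f ζ / (2 * h ζ)) / (h ζ + b) ^ 2) ζ := fun ζ hζ =>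
    ((hdf ζ hζ).add_const b).inv (hfar0 ζ hζ)
  -- The Schwarz lemma for the bounded function `1 / (h + b)`, whose derivative at `z` has modulus
  -- `‖f'(z)‖ / (8 ‖b‖³)`. The radius `4 / ‖b‖` thus produces the constant `8 * 4 = 32`.
  have hS := Complex.norm_deriv_le_div_of_mapsTo_ball (f := fun ζ => (h ζ + b)⁻¹) (c := z)
    (R₁ := R) (R₂ := 4 / ‖b‖) (fun ζ hζ => (hF ζ hζ).differentiableAt.differentiableWithinAt)
    (fun ζ hζ => ?_) hR
  · rw [(hF z hzB).deriv, ← hb, ← two_mul, norm_div, norm_neg, norm_div, norm_pow, norm_mul,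
      Complex.norm_two, div_div, div_div, div_le_div_iff₀ (by positivity) (by positivity)] at hS
    have h3 : ‖b‖ * (‖deriv f z‖ * R) ≤ ‖b‖ * (32 * ‖b‖ ^ 2) := by nlinarith
    have h4 := le_of_mul_le_mul_left h3 hb0
    rw [hbd] at h4
    linarith
  · rw [mem_closedBall, dist_eq_norm]
    refine (norm_sub_le _ _).trans ?_
    have h1 := hinv ζ hζ
    have h2 : ‖(h z + b)⁻¹‖ = 1 / 2 / ‖b‖ := by
      rw [← hb, ← two_mul, norm_inv, norm_mul, Complex.norm_two]
      field_simp
    rw [h2]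
    calc _ ≤ 5 / 2 / ‖b‖ + 1 / 2 / ‖b‖ := by gcongr
      _ = 3 / ‖b‖ := by ring
      _ ≤ _ := by gcongr; norm_num

/-- The inverse of a univalent holomorphic function is holomorphic. -/
theorem differentiableOn_symm (hf : DifferentiableOn ℂ f f.source) :
    DifferentiableOn ℂ f.symm f.target := by
  intro y hy
  refine DifferentiableAt.differentiableWithinAt ?_
  set x := f.symm y with hx
  have hxs : x ∈ f.source := f.map_target hy
  have han := hf.analyticOnNhd f.open_source
  -- Otherwise `f'` vanishes identically near `x` and `f` is locally constant, against injectivity.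
  have hev : ∀ᶠ ζ in 𝓝[≠] x, deriv f ζ ≠ 0 := by
    refine ((han.deriv x hxs).eventually_eq_zero_or_eventually_ne_zero).resolve_left fun h0 => ?_
    obtain ⟨r, hr, hball⟩ := Metric.eventually_nhds_iff_ball.1
      (h0.and (f.open_source.mem_nhds hxs))
    have hconst : ∀ ζ ∈ ball x r, f ζ = f x := fun ζ hζ =>
      isOpen_ball.is_const_of_deriv_eq_zero (convex_ball x r).isPreconnected
        (hf.mono fun ζ hζ => (hball ζ hζ).2) (fun ζ hζ => (hball ζ hζ).1) hζ (mem_ball_self hr)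
    have hmem : x + (r / 2 : ℝ) ∈ ball x r := by
      rw [mem_ball, dist_eq_norm]
      simp [abs_of_pos hr, hr]
    have := f.injOn (hball _ hmem).2 hxs (hconst _ hmem)
    simp [hr.ne'] at this
  have hcont : ContinuousAt f.symm y := f.continuousAt_symm hy
  have hev' : ∀ᶠ v in 𝓝 y, v ∈ f.target ∧ (v ≠ y → deriv f (f.symm v) ≠ 0) := by
    filter_upwards [f.open_target.mem_nhds hy,
      hcont.eventually (eventually_nhdsWithin_iff.1 hev)] with v hv h1
    refine ⟨hv, fun hne => h1 fun he => hne ?_⟩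
    rw [← f.right_inv hv, he, hx, f.right_inv hy]
  obtain ⟨s, hs, hso, hys⟩ := _root_.eventually_nhds_iff.1 hev'
  -- Possible zeros of `f'` are isolated, so the continuous inverse has at worst a removable
  -- singularity at `y`.
  refine ((Complex.differentiableOn_compl_singleton_and_continuousAt_iff
    (hso.mem_nhds hys)).1 ⟨fun v hv => ?_, hcont⟩).differentiableAt (hso.mem_nhds hys)
  obtain ⟨hvt, hvd⟩ := hs v hv.1
  exact (f.hasDerivAt_symm hvt (hvd hv.2) (hf.differentiableAt
    (f.open_source.mem_nhds (f.map_target hvt))).hasDerivAt).differentiableAt.differentiableWithinAt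

/-- The Koebe estimate on the ball of radius `d(x)` gives `‖f'(x)‖ ≤ 32 d'(f x) / d(x) < K`. -/
lemma eventually_norm_sub_le_of_univalent (hf : DifferentiableOn ℂ f f.source) {D : Set ℂ}
    (hD : IsDom D) (hs : D ⊆ f.source) (hne : D ≠ univ) (hne' : f '' D ≠ univ) {x : ℂ}
    (hx : x ∈ D) {K : ℝ} (hK : 32 * bdist (f '' D) (f x) / bdist D x < K) :
    ∀ᶠ y in 𝓝 x, ‖f y - f x‖ ≤ K * ‖y - x‖ := by
  have hd := bdist_pos hD.1 hne hx
  have hb := ball_bdist_subset hD.1 hx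
  have h1 : ‖deriv f x‖ * bdist D x / 32 ≤ bdist (f '' D) (f x) :=
    le_bdist (isDom_image hD hs).1 hne' (mem_image_of_mem f hx)
      ((ball_subset_image_ball hf hd (hb.trans hs)).trans (image_mono hb))
  have h2 : ‖deriv f x‖ < K := by
    refine lt_of_le_of_lt ?_ hK
    rw [le_div_iff₀ hd]
    linarith
  have h4 := (hf.differentiableAt (f.open_source.mem_nhds (hs hx))).hasDerivAt
  exact (hasDerivAt_iff_isLittleO.1 h4).def (sub_pos.2 h2) |>.mono fun y hy => by
    calc ‖f y - f x‖ = ‖(f y - f x - (y - x) • deriv f x) + (y - x) • deriv f x‖ := by simp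
      _ ≤ (K - ‖deriv f x‖) * ‖y - x‖ + ‖y - x‖ * ‖deriv f x‖ :=
        (norm_add_le _ _).trans (add_le_add hy (norm_smul_le _ _))
      _ = _ := by ring

/-- Univalent holomorphic functions are freely quasiconformal with a universal linear growth
function. -/
theorem isFQC_and_isQH_of_univalent (hf : DifferentiableOn ℂ f f.source)
    (hsrc : IsDom f.source) (hne : f.source ≠ univ) (hne' : f.target ≠ univ) :
    IsFQC (linearGrowth 32 (by norm_num)) f ∧ IsQH 32 f := by
  refine isFQC_and_isQH_of_eventually _ hsrc hne hne' (fun D hD hs x hx K hK => ?_)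
    fun D hD hs x hx K hK => ?_
  · refine eventually_norm_sub_le_of_univalent hf hD hs (fun he => hne ?_) (fun he => hne' ?_) hx hK
    · exact univ_subset_iff.1 (he ▸ hs)
    · refine univ_subset_iff.1 (he ▸ ?_)
      rintro _ ⟨x, hx, rfl⟩; exact f.map_source (hs hx)
  · refine eventually_norm_sub_le_of_univalent (f := f.symm) (differentiableOn_symm hf) hD hs
      (fun he => hne' ?_) (fun he => hne ?_) hx hK
    · exact univ_subset_iff.1 (he ▸ hs)
    · refine univ_subset_iff.1 (he ▸ ?_)
      rintro _ ⟨x, hx, rfl⟩; exact f.map_target (hs hx)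

end Univalent

/-! ### The distance ratio metric. -/

section DistanceRatio

open Metric Set Filter

lemma jDist_nonneg {E : Type*} [NormedAddCommGroup E] (D : Set E) (x y : E) : 0 ≤ jDist D x y :=
  Real.log_nonneg (le_add_of_nonneg_right
    (div_nonneg (norm_nonneg _) (le_min (bdist_nonneg _ _) (bdist_nonneg _ _))))

/-- Under the distance ratio inequality, pairs with bounded image distance ratio have bounded
distance ratio. -/
lemma JIneqOn.exists_jDist_le {E E' : Type*} [NormedAddCommGroup E] [NormedAddCommGroup E']
    {f : OpenPartialHomeomorph E E'} {φ : ℝ≥0 ≃ₜ ℝ≥0} {D : Set E} (h : JIneqOn φ f D) (c : ℝ) :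
    ∃ C, ∀ x ∈ D, ∀ y ∈ D, jDist (f '' D) (f x) (f y) ≤ c → jDist D x y ≤ C := by
  -- The left half of the inequality bounds the distance ratio by a value of `φ` on the compact
  -- interval `[0, c]`.
  obtain ⟨C, hC⟩ := ((isCompact_Icc (a := 0) (b := c.toNNReal)).image φ.continuous).bddAbove
  refine ⟨C, fun x hx y hy hle => ?_⟩
  have h1 := (h x hx y hy).1.trans hle
  have h2 : (jDist D x y).toNNReal ≤ C := by
    refine hC ⟨φ.symm (jDist D x y).toNNReal, ⟨bot_le, ?_⟩, φ.apply_symm_apply _⟩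
    rw [← NNReal.coe_le_coe]
    exact h1.trans (Real.le_coe_toNNReal c)
  calc jDist D x y = (jDist D x y).toNNReal := (Real.coe_toNNReal _ (jDist_nonneg _ _ _)).symm
    _ ≤ C := by exact_mod_cast h2

lemma jDist_le_of_le {E : Type*} [NormedAddCommGroup E] {D : Set E} {x y : E} {R m : ℝ} (hm : 0 < m)
    (hx : m ≤ bdist D x) (hy : m ≤ bdist D y) (hxy : ‖x - y‖ ≤ R) :
    jDist D x y ≤ Real.log (1 + R / m) := by
  have hmin : m ≤ min (bdist D x) (bdist D y) := le_min hx hy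
  have : 0 < min (bdist D x) (bdist D y) := hm.trans_le hmin
  refine Real.log_le_log (by positivity) ?_
  have h0 : 0 ≤ R := (norm_nonneg _).trans hxy
  gcongr

variable {E : Type*} [NormedAddCommGroup E] [NormedSpace ℝ E] {D : Set E}

/-- In a convex set the quasihyperbolic metric is controlled by the distance ratio metric of any
open subset. -/
lemma qhDist_le_exp_jDist {B : Set E} (hD : IsOpen D) (hB : IsOpen B) (hc : Convex ℝ B)
    (hne : B ≠ univ) (h : D ⊆ B) {x y : E} (hx : x ∈ D) (hy : y ∈ D) :
    qhDist B x y ≤ Real.exp (jDist D x y) - 1 := by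
  have hneD : D ≠ univ := fun he => hne (univ_subset_iff.1 (he ▸ h))
  have hdx := bdist_pos hD hneD hx
  have hdy := bdist_pos hD hneD hy
  have hm : 0 < min (bdist D x) (bdist D y) := lt_min hdx hdy
  set m := min (bdist D x) (bdist D y) with hmdef
  have he : Real.exp (jDist D x y) - 1 = ‖x - y‖ / m := by
    rw [jDist, Real.exp_log (by positivity)]
    ring
  rw [he]
  refine qhDist_le_of_segment hB hne hm (hc.segment_subset (h hx) (h hy)) fun z hz => ?_
  refine le_bdist hB hne (hc.segment_subset (h hx) (h hy) hz) fun w hw => ?_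
  -- Translating both endpoints by `w - z` keeps them in `B`; convexity then puts `w`, the translate
  -- of `z`, in `B`.
  have hsub : ∀ p ∈ D, m ≤ bdist D p → p + (w - z) ∈ B := fun p hp hmp => by
    refine h (ball_bdist_subset hD hp ?_)
    rw [mem_ball, dist_eq_norm] at hw ⊢
    simpa using hw.trans_le hmp
  have hx' := hsub x hx (min_le_left _ _)
  have hy' := hsub y hy (min_le_right _ _)
  obtain ⟨a, b, ha, hb, hab, rfl⟩ := hz
  have := hc hx' hy' ha hb hab
  convert this using 1
  have : w = w - (a • x + b • y) + (a • x + b • y) := by abel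
  simp only [smul_add]
  rw [show a • x + a • (w - (a • x + b • y)) + (b • y + b • (w - (a • x + b • y)))
    = (a • x + b • y) + (a + b) • (w - (a • x + b • y)) by rw [add_smul]; abel, hab, one_smul]
  abel

end DistanceRatio

/-! ### Failure of the inequality for the slit disk. -/

section Slit

open Metric Set Filter Complex

lemma notMem_slitDisk_of_mem_Ico {t : ℝ} (ht : t ∈ Ico (0 : ℝ) 1) : (t : ℂ) ∉ slitDisk :=
  fun h => h.2 ⟨t, ht, rfl⟩

lemma mem_slitDisk_of_im_ne_zero {z : ℂ} (hz : ‖z‖ < 1) (him : z.im ≠ 0) : z ∈ slitDisk :=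
  ⟨by simpa using hz, by rintro ⟨t, -, rfl⟩; simp at him⟩

lemma re_neg_of_mem_slitDisk {z : ℂ} (hz : z ∈ slitDisk) (him : z.im = 0) : z.re < 0 := by
  by_contra hre
  refine hz.2 ⟨z.re, ⟨not_lt.1 hre, ?_⟩, Complex.ext (by simp) (by simp [him])⟩
  have := hz.1
  rw [mem_ball, dist_zero_right] at this
  exact (le_abs_self _).trans_lt ((abs_re_le_norm z).trans_lt this)

lemma slitDisk_ne_univ : slitDisk ≠ univ := fun h =>
  notMem_slitDisk_of_mem_Ico (t := 0) (by simp) (h ▸ mem_univ _)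

lemma ball_ne_univ : ball (0 : ℂ) 1 ≠ univ := fun h => by
  have : (1 : ℂ) ∈ ball (0 : ℂ) 1 := h ▸ mem_univ _
  simp at this

lemma isDom_ball : IsDom (ball (0 : ℂ) 1) :=
  ⟨isOpen_ball, (convex_ball 0 1).isConnected ⟨0, by simp⟩⟩

lemma IsSlitMap.isDom_slitDisk {f : OpenPartialHomeomorph ℂ ℂ} (hf : IsSlitMap f) :
    IsDom slitDisk := by
  rw [← hf.2.1, ← f.image_source_eq_target]
  exact isDom_image (hf.1 ▸ isDom_ball) subset_rfl

/-- A path from `a` to `b` crosses the real axis, necessarily where the real part is negative, so it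
gets at least `1/2` away from `a`, while `a` is within `ε` of the slit. -/
lemma log_le_qhDist_slitDisk (hdom : IsDom slitDisk) {ε : ℝ} (hε : 0 < ε) {a b : ℂ}
    (ha : a ∈ slitDisk) (hb : b ∈ slitDisk) (hare : a.re = 1 / 2) (haim : a.im = ε)
    (hbim : b.im = -ε) : Real.log (1 + 1 / 2 / ε) ≤ qhDist slitDisk a b := by
  refine le_qhDist hdom slitDisk_ne_univ ha hb fun L γ hγ => ?_
  have hc : ContinuousOn (fun t => (γ t).im) (Icc 0 L) :=
    continuous_im.comp_continuousOn hγ.2.1.continuousOn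
  obtain ⟨t, ht, h0⟩ : ∃ t ∈ Icc 0 L, (γ t).im = 0 := by
    refine intermediate_value_Icc' hγ.1 hc ⟨?_, ?_⟩
    · rw [hγ.2.2.2.2]; linarith
    · rw [hγ.2.2.2.1]; linarith
  have hneg := re_neg_of_mem_slitDisk (hγ.2.2.1 t ht) h0
  have hdist : 1 / 2 ≤ dist a (γ t) := by
    rw [dist_eq_norm]
    refine le_trans ?_ (abs_re_le_norm _)
    rw [sub_re, hare]
    exact le_trans (by linarith) (le_abs_self _)
  refine le_trans ?_ (hγ.log_le_qhLength hdom.1 slitDisk_ne_univ ha ht hdist (by norm_num))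
  have hd := bdist_pos hdom.1 slitDisk_ne_univ ha
  have hle : bdist slitDisk a ≤ ε := by
    refine (bdist_le_dist hdom.1 ha
      (notMem_slitDisk_of_mem_Ico (t := 1 / 2) (by norm_num))).trans_eq ?_
    rw [dist_eq_norm, show a - ((1 / 2 : ℝ) : ℂ) = ε * I by
      apply Complex.ext <;> simp [hare, haim]]
    simp [abs_of_pos hε]
  refine Real.log_le_log (by positivity) ?_
  gcongr

/-- A conformal map onto the slit disk violates the distance ratio inequality on every open subset
of the disk whose image contains all points of the slit disk off the real axis. -/
lemma IsSlitMap.not_jIneqOn {f : OpenPartialHomeomorph ℂ ℂ} (hf : IsSlitMap f) (φ : ℝ≥0 ≃ₜ ℝ≥0)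
    {D : Set ℂ} (hD : IsOpen D) (hs : D ⊆ ball 0 1)
    (hI : ∀ z ∈ slitDisk, z.im ≠ 0 → f.symm z ∈ D) : ¬ JIneqOn φ f D := by
  intro hJ
  have hdom := hf.isDom_slitDisk
  obtain ⟨-, hQH⟩ := isFQC_and_isQH_of_univalent hf.2.2 (hf.1 ▸ isDom_ball)
    (hf.1 ▸ ball_ne_univ) (hf.2.1 ▸ slitDisk_ne_univ)
  obtain ⟨C, hC⟩ := hJ.exists_jDist_le (Real.log 3)
  have hsD : D ⊆ f.source := hf.1 ▸ hs
  have hopen : IsOpen (f '' D) := f.isOpen_image_of_subset_source hD hsD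
  have hne : f '' D ≠ univ := fun he => slitDisk_ne_univ (univ_subset_iff.1 (by
    rw [← he, ← hf.2.1]
    rintro _ ⟨x, hx, rfl⟩; exact f.map_source (hsD hx)))
  have hmem : ∀ z : ℂ, ‖z‖ < 1 → z.im ≠ 0 → z ∈ f '' D := fun z hz him =>
    ⟨f.symm z, hI z (mem_slitDisk_of_im_ne_zero hz him) him,
      f.right_inv (hf.2.1 ▸ mem_slitDisk_of_im_ne_zero hz him)⟩
  -- Chain of estimates: `log (1 + 1/(2ε)) ≤ k_slit ≤ 32 k_disk ≤ 32 (exp j_D - 1)`. The bound `ε <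
  -- 1/4` keeps the `ε`-balls about `1/2 ± iε` inside the unit disk.
  have key : ∀ ε : ℝ, 0 < ε → ε < 1 / 4 →
      Real.log (1 + 1 / 2 / ε) ≤ 32 * (Real.exp C - 1) := by
    intro ε hε hε4
    have hball : ∀ s : ℝ, |s| = ε → ball (1 / 2 + s * I : ℂ) ε ⊆ f '' D := fun s hs z hz => by
      rw [mem_ball, dist_eq_norm] at hz
      refine hmem z ?_ fun h0 => ?_
      · have h1 : z = (z - (1 / 2 + s * I)) + 1 / 2 + s * I := by ring
        have h2 : ‖(s : ℂ) * I‖ = ε := by simpa using hs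
        rw [h1]
        refine (norm_add_le _ _).trans_lt ?_
        have h3 := norm_add_le (z - (1 / 2 + s * I)) (1 / 2)
        have h4 : ‖(1 / 2 : ℂ)‖ = 1 / 2 := by simp
        linarith
      · have := (abs_im_le_norm (z - (1 / 2 + s * I))).trans_lt hz
        simp [h0, hs] at this
    have hpt : ∀ s : ℝ, |s| = ε → ‖(1 / 2 + s * I : ℂ)‖ < 1 ∧ (1 / 2 + s * I : ℂ).im ≠ 0 :=
      fun s hs => by
        constructor
        · refine (norm_add_le _ _).trans_lt ?_
          simp only [norm_mul, norm_I, norm_real, Real.norm_eq_abs, hs]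
          norm_num
          linarith
        · have : s ≠ 0 := fun h => by simp [h] at hs; linarith
          simpa using this
    have hpos : |ε| = ε := abs_of_pos hε
    have hneg : |-ε| = ε := by rw [abs_neg, hpos]
    set a : ℂ := 1 / 2 + ε * I with ha
    set b : ℂ := 1 / 2 + (-ε : ℝ) * I with hb
    have haS : a ∈ slitDisk := mem_slitDisk_of_im_ne_zero (hpt _ hpos).1 (hpt _ hpos).2
    have hbS : b ∈ slitDisk := mem_slitDisk_of_im_ne_zero (hpt _ hneg).1 (hpt _ hneg).2
    have hx : f.symm a ∈ D := hI a haS (hpt _ hpos).2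
    have hy : f.symm b ∈ D := hI b hbS (hpt _ hneg).2
    have fa : f (f.symm a) = a := f.right_inv (hf.2.1 ▸ haS)
    have fb : f (f.symm b) = b := f.right_inv (hf.2.1 ▸ hbS)
    have hj := hC _ hx _ hy (by
      rw [fa, fb]
      refine (jDist_le_of_le (R := 2 * ε) hε
        (le_bdist hopen hne (hmem _ (hpt _ hpos).1 (hpt _ hpos).2) (hball _ hpos))
        (le_bdist hopen hne (hmem _ (hpt _ hneg).1 (hpt _ hneg).2) (hball _ hneg)) ?_).trans_eq ?_
      · rw [show a - b = ((2 * ε : ℝ) : ℂ) * I by rw [ha, hb]; push_cast; ring]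
        rw [norm_mul, norm_I, norm_real, Real.norm_eq_abs, abs_of_pos (by linarith), mul_one]
      · rw [mul_div_cancel_right₀ _ hε.ne']; norm_num)
    have hk := qhDist_le_exp_jDist hD isOpen_ball (convex_ball 0 1) ball_ne_univ hs hx hy
    have hq := (hQH _ (hsD hx) _ (hsD hy)).2
    rw [fa, fb, hf.1, hf.2.1] at hq
    have hl := log_le_qhDist_slitDisk hdom hε haS hbS (by simp [ha]) (by simp [ha]) (by simp [hb])
    have he := Real.exp_le_exp.2 hj
    linarith
  set K := 32 * (Real.exp C - 1)
  have hKe := Real.exp_pos (|K| + 1)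
  -- With this choice `1/(2ε) = 4 exp (|K| + 1)`, which exceeds `exp K`.
  set ε := 1 / 8 * Real.exp (-(|K| + 1)) with hεdef
  have hε : 0 < ε := by positivity
  have hε4 : ε < 1 / 4 := by
    have : Real.exp (-(|K| + 1)) ≤ 1 := Real.exp_le_one_iff.2 (by linarith [abs_nonneg K])
    linarith
  have h1 := key ε hε hε4
  have h2 : 1 / 2 / ε = 4 * Real.exp (|K| + 1) := by
    rw [hεdef, Real.exp_neg]
    field_simp
    norm_num
  rw [h2, Real.log_le_iff_le_exp (by positivity)] at h1
  have h3 : Real.exp K ≤ Real.exp (|K| + 1) := Real.exp_le_exp.2 (by linarith [le_abs_self K])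
  linarith

lemma IsSlitMap.not_jIneqOn_ball {f : OpenPartialHomeomorph ℂ ℂ} (hf : IsSlitMap f)
    (φ : ℝ≥0 ≃ₜ ℝ≥0) : ¬ JIneqOn φ f (ball 0 1) :=
  hf.not_jIneqOn φ isOpen_ball subset_rfl fun _ hz _ => hf.1 ▸ f.map_target (hf.2.1 ▸ hz)

/-- The argument only uses non-real points of the slit disk, and `-1/2` is real. -/
lemma IsSlitMap.not_jIneqOn_punctured {f : OpenPartialHomeomorph ℂ ℂ} (hf : IsSlitMap f)
    (φ : ℝ≥0 ≃ₜ ℝ≥0) : ¬ JIneqOn φ f (ball 0 1 \ {f.symm (-1 / 2)}) := by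
  refine hf.not_jIneqOn φ (isOpen_ball.sdiff isClosed_singleton) sdiff_subset fun _ hz him =>
    ⟨hf.1 ▸ f.map_target (hf.2.1 ▸ hz), fun h => him ?_⟩
  have hmem : (-1 / 2 : ℂ) ∈ slitDisk := by
    refine ⟨by simp; norm_num, ?_⟩
    rintro ⟨t, ht, he⟩
    have := congrArg re he
    norm_num at this
    linarith [ht.1]
  have e : f.symm.source = slitDisk := hf.2.1
  have := f.symm.injOn (by rwa [e]) (by rwa [e]) h
  rw [this]
  norm_num

end Slit

/-! ### An explicit conformal map onto the slit disk. -/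

section SlitMap

open Metric Set Filter Complex

/-- An injective holomorphic function on a domain, as a homeomorphism onto its image. -/
lemma exists_openPartialHomeomorph_of_injOn {g : ℂ → ℂ} {U : Set ℂ} (hU : IsDom U)
    (hg : DifferentiableOn ℂ g U) (hinj : InjOn g U) :
    ∃ f : OpenPartialHomeomorph ℂ ℂ, f.source = U ∧ f.target = g '' U ∧ ⇑f = g := by
  have hopen : ∀ s ⊆ U, IsOpen s → IsOpen (g '' s) := by
    -- The open mapping theorem; injectivity rules out the constant alternative.
    refine ((hg.analyticOnNhd hU.1).is_constant_or_isOpen hU.2.isPreconnected).resolve_left ?_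
    rintro ⟨w, hw⟩
    obtain ⟨x, hx⟩ := hU.2.nonempty
    obtain ⟨r, hr, h⟩ := Metric.isOpen_iff.1 hU.1 x hx
    have hmem : x + (r / 2 : ℝ) ∈ U := h (by
      rw [mem_ball, dist_eq_norm]
      simp [abs_of_pos hr, hr])
    have := hinj hmem hx ((hw _ hmem).trans (hw _ hx).symm)
    simp [hr.ne'] at this
  have hrestr : IsOpenMap (U.domRestrict g) := by
    intro s hs
    rw [Set.domRestrict_eq, image_comp]
    exact hopen _ (by rintro _ ⟨x, -, rfl⟩; exact x.2) (hU.1.isOpenMap_subtype_val s hs)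
  exact ⟨OpenPartialHomeomorph.ofContinuousOpenRestrict (hinj.toPartialEquiv g U) hg.continuousOn
    hrestr hU.1, rfl, rfl, rfl⟩

/-- The Möbius transformation of the unit disk onto the right half plane. -/
def cayley (w : ℂ) : ℂ := (1 + w) / (1 - w)

/-- The inverse of `cayley`. -/
def cayleyInv (q : ℂ) : ℂ := (q - 1) / (q + 1)

lemma cayley_cayleyInv {q : ℂ} (hq : q + 1 ≠ 0) : cayley (cayleyInv q) = q := by
  have : q + 1 - (q - 1) ≠ 0 := by ring_nf; norm_num
  rw [cayley, cayleyInv]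
  field_simp
  ring

lemma cayleyInv_cayley {w : ℂ} (hw : 1 - w ≠ 0) : cayleyInv (cayley w) = w := by
  rw [cayley, cayleyInv]
  have : (1 + w) + (1 - w) ≠ 0 := by ring_nf; norm_num
  field_simp
  ring

lemma cayley_re (w : ℂ) : (cayley w).re = (1 - normSq w) / normSq (1 - w) := by
  rw [cayley, div_re, ← add_div]
  simp [normSq_apply]
  ring

lemma cayley_im (w : ℂ) : (cayley w).im = 2 * w.im / normSq (1 - w) := by
  rw [cayley, div_im, ← sub_div]
  simp [normSq_apply]
  ring

lemma cayleyInv_im (q : ℂ) : (cayleyInv q).im = 2 * q.im / normSq (q + 1) := by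
  rw [cayleyInv, div_im, ← sub_div]
  simp [normSq_apply]
  ring

lemma norm_cayleyInv_lt_one {q : ℂ} (hq : 0 < q.re) : ‖cayleyInv q‖ < 1 := by
  have h1 : q + 1 ≠ 0 := fun h => by
    have := congrArg re h
    simp at this
    linarith
  rw [cayleyInv, norm_div, div_lt_one (norm_pos_iff.2 h1),
    ← sq_lt_sq₀ (norm_nonneg _) (norm_nonneg _), ← normSq_eq_norm_sq, ← normSq_eq_norm_sq]
  simp [normSq_apply]
  nlinarith

lemma one_sub_ne_zero_of_norm_lt {w : ℂ} (hw : ‖w‖ < 1) : 1 - w ≠ 0 := fun h => by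
  rw [← sub_eq_zero.1 h] at hw
  simp at hw

lemma normSq_lt_one {w : ℂ} (hw : ‖w‖ < 1) : normSq w < 1 := by
  rw [normSq_eq_norm_sq]
  nlinarith [norm_nonneg w]

lemma cpow_half_sq (v : ℂ) : (v ^ (1 / 2 : ℂ)) ^ 2 = v := by
  simp

/-- The principal root halves an argument in `(0, π)`, so it lands in the open first quadrant. -/
lemma cpow_half_re_im_pos {v : ℂ} (hv : 0 < v.im) :
    0 < (v ^ (1 / 2 : ℂ)).re ∧ 0 < (v ^ (1 / 2 : ℂ)).im := by
  have h0 : v ≠ 0 := fun h => by simp [h] at hv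
  have harg : 0 < arg v ∧ arg v < Real.pi := by
    refine ⟨lt_of_le_of_ne (arg_nonneg_iff.2 hv.le) fun h => ?_,
      lt_of_le_of_ne (arg_le_pi v) fun h => ?_⟩
    · have := (arg_eq_zero_iff.1 h.symm).2
      linarith
    · have := (arg_eq_pi_iff.1 h).2
      linarith
  have him : (log v * (1 / 2)).im = arg v / 2 := by
    rw [show (1 / 2 : ℂ) = ((1 / 2 : ℝ) : ℂ) by norm_num, mul_comm, im_ofReal_mul, log_im]
    ring
  rw [cpow_def_of_ne_zero h0, exp_re, exp_im, him]
  exact ⟨mul_pos (Real.exp_pos _) (Real.cos_pos_of_mem_Ioo ⟨by linarith [Real.pi_pos], by linarith⟩),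
    mul_pos (Real.exp_pos _) (Real.sin_pos_of_pos_of_lt_pi (by linarith) (by linarith [Real.pi_pos]))⟩

/-- A conformal map of the unit disk onto the slit disk: the disk is mapped onto the upper half
plane, the first quadrant, the upper half disk and finally the slit disk. -/
def slitMap (z : ℂ) : ℂ := cayleyInv ((I * cayley z) ^ (1 / 2 : ℂ)) ^ 2

lemma im_I_mul_cayley_pos {z : ℂ} (hz : ‖z‖ < 1) : 0 < (I * cayley z).im := by
  rw [I_mul_im, cayley_re]
  exact div_pos (sub_pos.2 (normSq_lt_one hz)) (normSq_pos.2 (one_sub_ne_zero_of_norm_lt hz))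

lemma add_one_ne_zero_of_re_pos {q : ℂ} (hq : 0 < q.re) : q + 1 ≠ 0 := fun h => by
  have := congrArg re h
  simp at this
  linarith

lemma cayleyInv_im_pos {q : ℂ} (h1 : 0 < q.re) (h2 : 0 < q.im) : 0 < (cayleyInv q).im := by
  rw [cayleyInv_im]
  exact div_pos (by linarith) (normSq_pos.2 (add_one_ne_zero_of_re_pos h1))

lemma eq_of_sq_eq_of_im_pos {a b : ℂ} (ha : 0 < a.im) (hb : 0 < b.im) (h : a ^ 2 = b ^ 2) :
    a = b := by
  rcases sq_eq_sq_iff_eq_or_eq_neg.1 h with h | h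
  · exact h
  · have := congrArg im h
    simp at this
    linarith

lemma differentiableOn_slitMap : DifferentiableOn ℂ slitMap (ball 0 1) := by
  intro z hz
  rw [mem_ball, dist_zero_right] at hz
  have h1 : DifferentiableAt ℂ cayley z :=
    DifferentiableAt.div (by fun_prop) (by fun_prop) (one_sub_ne_zero_of_norm_lt hz)
  have hv := im_I_mul_cayley_pos hz
  have h2 : DifferentiableAt ℂ (fun z => (I * cayley z) ^ (1 / 2 : ℂ)) z :=
    (h1.const_mul I).cpow_const (Or.inr hv.ne')
  have h3 : DifferentiableAt ℂ (fun z => cayleyInv ((I * cayley z) ^ (1 / 2 : ℂ))) z :=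
    (h2.sub_const 1).div (h2.add_const 1)
      (add_one_ne_zero_of_re_pos (cpow_half_re_im_pos hv).1)
  exact (h3.pow 2).differentiableWithinAt

lemma injOn_slitMap : InjOn slitMap (ball 0 1) := by
  intro z hz z' hz' h
  rw [mem_ball, dist_zero_right] at hz hz'
  obtain ⟨r, i⟩ := cpow_half_re_im_pos (im_I_mul_cayley_pos hz)
  obtain ⟨r', i'⟩ := cpow_half_re_im_pos (im_I_mul_cayley_pos hz')
  have h1 := eq_of_sq_eq_of_im_pos (cayleyInv_im_pos r i) (cayleyInv_im_pos r' i') h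
  have h2 := congrArg cayley h1
  rw [cayley_cayleyInv (add_one_ne_zero_of_re_pos r),
    cayley_cayleyInv (add_one_ne_zero_of_re_pos r')] at h2
  have h3 := congrArg (· ^ 2) h2
  simp only [cpow_half_sq] at h3
  have h4 := congrArg cayleyInv (mul_left_cancel₀ I_ne_zero h3)
  rwa [cayleyInv_cayley (one_sub_ne_zero_of_norm_lt hz),
    cayleyInv_cayley (one_sub_ne_zero_of_norm_lt hz')] at h4

lemma image_slitMap : slitMap '' ball 0 1 = slitDisk := by
  apply Subset.antisymm
  · rintro _ ⟨z, hz, rfl⟩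
    rw [mem_ball, dist_zero_right] at hz
    obtain ⟨r, i⟩ := cpow_half_re_im_pos (im_I_mul_cayley_pos hz)
    have hn := norm_cayleyInv_lt_one r
    have hi := cayleyInv_im_pos r i
    rw [slitMap]
    set w := cayleyInv ((I * cayley z) ^ (1 / 2 : ℂ))
    refine ⟨?_, ?_⟩
    · rw [mem_ball, dist_zero_right, norm_pow]
      exact pow_lt_one₀ (norm_nonneg _) hn two_ne_zero
    · rintro ⟨t, ht, he⟩
      have e1 : w ^ 2 = ((√t : ℝ) : ℂ) ^ 2 := by
        rw [← he, ← ofReal_pow, Real.sq_sqrt ht.1]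
      rcases sq_eq_sq_iff_eq_or_eq_neg.1 e1 with h | h <;> simp [h] at hi
  · intro u hu
    -- One of the two roots of `u` is in the upper half plane, for a real root would make `u` real
    -- and non-negative.
    obtain ⟨w, hw, hwi⟩ : ∃ w : ℂ, w ^ 2 = u ∧ 0 < w.im := by
      have hw : (u ^ (1 / 2 : ℂ)) ^ 2 = u := cpow_half_sq u
      set w := u ^ (1 / 2 : ℂ)
      rcases lt_trichotomy w.im 0 with h | h | h
      · exact ⟨-w, by rw [neg_sq, hw], by simpa using h⟩
      · exfalso
        have e1 : u.im = 0 := by rw [← hw, sq, mul_im, h]; ring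
        have e2 : 0 ≤ u.re := by rw [← hw, sq, mul_re, h]; nlinarith
        exact (re_neg_of_mem_slitDisk hu e1).not_ge e2
      · exact ⟨w, hw, h⟩
    have hun : ‖u‖ < 1 := by simpa using hu.1
    have hwn : ‖w‖ < 1 := by
      rw [← hw, norm_pow] at hun
      nlinarith [norm_nonneg w]
    have hw1 := one_sub_ne_zero_of_norm_lt hwn
    set q := cayley w with hq
    have hqr : 0 < q.re := by
      rw [hq, cayley_re]
      exact div_pos (sub_pos.2 (normSq_lt_one hwn)) (normSq_pos.2 hw1)
    have hqi : 0 < q.im := by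
      rw [hq, cayley_im]
      exact div_pos (by linarith) (normSq_pos.2 hw1)
    -- This real part is `2 q.re q.im`, so the point lies in the image of the disk under `cayley`.
    have hp : 0 < (-I * q ^ 2).re := by
      simp [sq]
      nlinarith [mul_pos hqr hqi]
    refine ⟨cayleyInv (-I * q ^ 2), by simpa using norm_cayleyInv_lt_one hp, ?_⟩
    have e1 : I * cayley (cayleyInv (-I * q ^ 2)) = q ^ 2 := by
      rw [cayley_cayleyInv (add_one_ne_zero_of_re_pos hp), ← mul_assoc, mul_neg, I_mul_I]
      ring
    have hqv : 0 < (q ^ 2).im := by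
      simp [sq]
      nlinarith [mul_pos hqr hqi]
    have e2 : (q ^ 2) ^ (1 / 2 : ℂ) = q :=
      eq_of_sq_eq_of_im_pos (cpow_half_re_im_pos hqv).2 hqi (cpow_half_sq _)
    rw [slitMap, e1, e2, hq, cayleyInv_cayley hw1, hw]

lemma exists_isSlitMap : ∃ f : OpenPartialHomeomorph ℂ ℂ, IsSlitMap f := by
  obtain ⟨f, h1, h2, h3⟩ := exists_openPartialHomeomorph_of_injOn isDom_ball
    differentiableOn_slitMap injOn_slitMap
  refine ⟨f, h1, h2.trans image_slitMap, ?_⟩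
  rw [h1, h3]
  exact differentiableOn_slitMap

end SlitMap

/-! ### Locally bilipschitz homeomorphisms. -/

section LocallyBilipschitz

open Metric Set Filter

lemma IsLocBilip.symm {E E' : Type*} [NormedAddCommGroup E] [NormedAddCommGroup E']
    {f : OpenPartialHomeomorph E E'} {M : ℝ} (hM : 1 ≤ M) (hf : IsLocBilip M f) :
    IsLocBilip M f.symm := by
  have hM0 : 0 < M := by linarith
  intro y hy
  obtain ⟨U, hU, hUs, h⟩ := hf (f.symm y) (f.map_target hy)
  refine ⟨f '' U, ?_, ?_, ?_⟩
  · have := f.image_mem_nhds (f.map_target hy) hU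
    rwa [f.right_inv hy] at this
  · rintro _ ⟨u, hu, rfl⟩
    exact f.map_source (hUs hu)
  · rintro _ ⟨u, hu, rfl⟩ _ ⟨v, hv, rfl⟩
    rw [f.left_inv (hUs hu), f.left_inv (hUs hv)]
    obtain ⟨h1, h2⟩ := h u hu v hv
    exact ⟨(div_le_iff₀' hM0).2 h2, (div_le_iff₀' hM0).1 h1⟩

variable {E : Type*} [NormedAddCommGroup E] [NormedSpace ℝ E]
variable {E' : Type*} [NormedAddCommGroup E'] [NormedSpace ℝ E']
variable {f : OpenPartialHomeomorph E E'} {M : ℝ}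

lemma norm_sub_le_of_locally_lipschitz {E : Type*} [NormedAddCommGroup E] {p : ℝ → E} {a b C : ℝ}
    (hab : a ≤ b) (hc : ContinuousOn p (Icc a b))
    (hloc : ∀ s ∈ Ico a b, ∀ᶠ z in 𝓝[>] s, ‖p z - p s‖ ≤ C * (z - s)) :
    ‖p b - p a‖ ≤ C * (b - a) := by
  refine image_le_of_liminf_slope_right_le_deriv_boundary (f := fun u => ‖p u - p a‖)
    (B := fun u => C * (u - a)) (B' := fun _ => C) (hc.sub continuousOn_const).norm (by simp)
    (by fun_prop) (fun s _ => ?_) (fun s hs r hr => ?_) (right_mem_Icc.2 hab)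
  · have := ((hasDerivAt_id s).sub_const a).const_mul C
    simpa using this.hasDerivWithinAt
  · refine Eventually.frequently ?_
    filter_upwards [hloc s hs, self_mem_nhdsWithin] with z hz hzs
    have h0 : 0 < z - s := sub_pos.2 hzs
    rw [slope_def_field, div_lt_iff₀ h0]
    have := norm_sub_norm_le (p z - p a) (p s - p a)
    rw [sub_sub_sub_cancel_right] at this
    nlinarith

/-- A locally `M`-bilipschitz homeomorphism maps balls of radius `R` onto sets that contain the
concentric balls of radius `R / M`. -/
theorem IsLocBilip.ball_subset_image_ball {E : Type*} [NormedAddCommGroup E] [CompleteSpace E]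
    {f : OpenPartialHomeomorph E E'} (hM : 1 ≤ M) (hf : IsLocBilip M f) {x : E} {R : ℝ} (hR : ball x R ⊆ f.source) : ball (f x) (R / M) ⊆ f '' ball x R := by
  intro w hw
  by_contra hwV
  have hM0 : 0 < M := by linarith
  rw [mem_ball, dist_eq_norm, lt_div_iff₀' hM0] at hw
  set V := f '' ball x R with hV
  have hVo : IsOpen V := f.isOpen_image_of_subset_source isOpen_ball hR
  have hxB : x ∈ ball x R := mem_ball_self (lt_of_le_of_lt (by positivity) hw)
  have hVt : V ⊆ f.target := by
    rintro _ ⟨u, hu, rfl⟩; exact f.map_source (hR hu)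
  set y : ℝ → E' := fun s => f x + s • (w - f x) with hy
  have hyc : Continuous y := by fun_prop
  -- The segment from `f x` to `w` is lifted by `f.symm` up to the first parameter `τ` at which it
  -- leaves `V`.
  have hC : IsCompact (Icc (0 : ℝ) 1 ∩ y ⁻¹' Vᶜ) :=
    isCompact_Icc.inter_right (hVo.isClosed_compl.preimage hyc)
  obtain ⟨τ, ⟨hτI, hτV⟩, hτmin⟩ := hC.exists_isLeast ⟨1, by simp, by simpa [hy] using hwV⟩
  have hτ0 : 0 < τ := lt_of_le_of_ne hτI.1 fun h => hτV (by
    have : y 0 = f x := by simp [hy]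
    rw [← h]; exact this ▸ mem_image_of_mem f hxB)
  have hyV : ∀ s, 0 ≤ s → s < τ → y s ∈ V := fun s h0 h1 => by
    by_contra hs
    exact h1.not_ge (hτmin ⟨⟨h0, h1.le.trans hτI.2⟩, hs⟩)
  set p : ℝ → E := fun s => f.symm (y s) with hp
  have hpc : ∀ s, 0 ≤ s → s < τ → ContinuousAt p s := fun s h0 h1 =>
    ContinuousAt.comp (f.continuousAt_symm (hVt (hyV s h0 h1))) hyc.continuousAt
  have hlip : ∀ s t, 0 ≤ s → s ≤ t → t < τ → ‖p t - p s‖ ≤ M * ‖w - f x‖ * (t - s) := by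
    intro s t hs hst ht
    refine norm_sub_le_of_locally_lipschitz hst (fun u hu =>
      (hpc u (hs.trans hu.1) (hu.2.trans_lt ht)).continuousWithinAt) fun u hu => ?_
    obtain ⟨U, hU, -, hUl⟩ := hf.symm hM (y u) (hVt (hyV u (hs.trans hu.1) (hu.2.trans ht)))
    filter_upwards [(hyc.continuousAt.eventually hU).filter_mono nhdsWithin_le_nhds,
      self_mem_nhdsWithin] with z hz hzu
    refine (hUl _ hz _ (mem_of_mem_nhds hU)).2.trans_eq ?_
    rw [hy]
    simp only
    rw [add_sub_add_left_eq_sub, ← sub_smul, norm_smul, Real.norm_eq_abs,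
      abs_of_pos (sub_pos.2 hzu)]
    ring
  set ℓ := M * ‖w - f x‖ with hℓ
  have hℓ0 : 0 ≤ ℓ := by positivity
  set s : ℕ → ℝ := fun n => τ - τ * (1 / ((n : ℝ) + 1)) with hs
  have hslt : ∀ n, s n < τ := fun n => by
    have : 0 < τ * (1 / ((n : ℝ) + 1)) := by positivity
    simp only [hs]; linarith
  have hs0 : ∀ n, 0 ≤ s n := fun n => by
    have h1 : 1 / ((n : ℝ) + 1) ≤ 1 := by
      rw [div_le_one (by positivity)]; linarith [n.cast_nonneg (α := ℝ)]
    simp only [hs]; nlinarith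
  have hsmono : ∀ N n : ℕ, N ≤ n → s N ≤ s n := fun N n h => by
    simp only [hs]
    gcongr
  have hone := tendsto_one_div_add_atTop_nhds_zero_nat (𝕜 := ℝ)
  -- The lift is Lipschitz with constant `ℓ < R`, so it has a limit at `τ` by completeness, still
  -- inside the ball. Applying `f` to this limit puts `y τ` in `V`, a contradiction.
  have hcauchy : CauchySeq fun n => p (s n) := by
    refine cauchySeq_of_le_tendsto_0 (fun N => ℓ * (τ * (1 / ((N : ℝ) + 1)))) ?_ ?_
    · intro n m N hn hm
      wlog hnm : n ≤ m generalizing n m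
      · rw [dist_comm]; exact this m n hm hn (le_of_not_ge hnm)
      rw [dist_comm, dist_eq_norm]
      refine (hlip _ _ (hs0 n) (hsmono _ _ hnm) (hslt m)).trans ?_
      gcongr
      have h1 := hsmono N n hn
      have h2 := hslt m
      simp only [hs] at h1 h2 ⊢
      linarith
    · simpa using (hone.const_mul τ).const_mul ℓ
  obtain ⟨q, hq⟩ := cauchySeq_tendsto_of_complete hcauchy
  have hp0 : p 0 = x := by
    simp only [hp, hy, zero_smul, add_zero]
    exact f.left_inv (hR hxB)
  have hqB : q ∈ ball x R := by
    rw [mem_ball, dist_eq_norm]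
    refine lt_of_le_of_lt (le_of_tendsto' (hq.sub_const x).norm fun n => ?_) hw
    have := hlip 0 (s n) le_rfl (hs0 n) (hslt n)
    rw [hp0, sub_zero] at this
    refine this.trans (mul_le_of_le_one_right hℓ0 ((hslt n).le.trans hτI.2))
  have hsτ : Tendsto s atTop (𝓝 τ) := by
    have := (hone.const_mul τ).const_sub τ
    rwa [mul_zero, sub_zero] at this
  have h1 : Tendsto (fun n => f (p (s n))) atTop (𝓝 (f q)) :=
    (f.continuousAt (hR hqB)).tendsto.comp hq
  have h2 : Tendsto (fun n => f (p (s n))) atTop (𝓝 (y τ)) := by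
    refine ((hyc.tendsto τ).comp hsτ).congr fun n => ?_
    exact (f.right_inv (hVt (hyV _ (hs0 n) (hslt n)))).symm
  exact hτV (tendsto_nhds_unique h1 h2 ▸ mem_image_of_mem f hqB)

lemma IsLocBilip.le_bdist_image [CompleteSpace E] (hM : 1 ≤ M) (hf : IsLocBilip M f)
    {D : Set E} (hD : IsOpen D) (hs : D ⊆ f.source) (hne : f '' D ≠ univ) {x : E} (hx : x ∈ D) :
    bdist D x / M ≤ bdist (f '' D) (f x) := by
  have hb := ball_bdist_subset hD hx
  exact le_bdist (f.isOpen_image_of_subset_source hD hs) hne (mem_image_of_mem f hx)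
    ((hf.ball_subset_image_ball hM (hb.trans hs)).trans (image_mono hb))

/-- Since `d(x) ≤ M d'(f x)`, the local Lipschitz constant `M` is at most `M² d'(f x) / d(x)`. -/
lemma IsLocBilip.eventually_norm_sub_le [CompleteSpace E] (hM : 1 ≤ M) (hf : IsLocBilip M f)
    {D : Set E} (hD : IsOpen D) (hs : D ⊆ f.source) (hneD : D ≠ univ) (hne : f '' D ≠ univ) {x : E}
    (hx : x ∈ D) {K : ℝ} (hK : M ^ 2 * bdist (f '' D) (f x) / bdist D x < K) :
    ∀ᶠ y in 𝓝 x, ‖f y - f x‖ ≤ K * ‖y - x‖ := by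
  have hM0 : 0 < M := by linarith
  have hd := bdist_pos hD hneD hx
  have h1 := hf.le_bdist_image hM hD hs hne hx
  have h2 : M ≤ K := by
    refine le_trans ?_ hK.le
    rw [div_le_iff₀ hM0] at h1
    rw [le_div_iff₀ hd]
    nlinarith
  obtain ⟨U, hU, -, hUl⟩ := hf x (hs hx)
  filter_upwards [hU] with y hy
  exact (hUl y hy x (mem_of_mem_nhds hU)).2.trans (by gcongr)

/-- Locally `M`-bilipschitz homeomorphisms are freely quasiconformal. -/
theorem IsLocBilip.isFQC_and_isQH [CompleteSpace E] [CompleteSpace E'] (hM : 1 ≤ M)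
    (hf : IsLocBilip M f) (hsrc : IsDom f.source) (hne : f.source ≠ univ)
    (hne' : f.target ≠ univ) :
    IsFQC (linearGrowth (M ^ 2) (one_le_pow₀ hM)) f ∧ IsQH (M ^ 2) f := by
  refine isFQC_and_isQH_of_eventually _ hsrc hne hne' (fun D hD hs x hx K hK => ?_)
    fun D hD hs x hx K hK => ?_
  · refine hf.eventually_norm_sub_le hM hD.1 hs (fun he => hne ?_) (fun he => hne' ?_) hx hK
    · exact univ_subset_iff.1 (he ▸ hs)
    · refine univ_subset_iff.1 (he ▸ ?_)
      rintro _ ⟨x, hx, rfl⟩; exact f.map_source (hs hx)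
  · refine (hf.symm hM).eventually_norm_sub_le hM hD.1 hs (fun he => hne' ?_) (fun he => hne ?_)
      hx hK
    · exact univ_subset_iff.1 (he ▸ hs)
    · refine univ_subset_iff.1 (he ▸ ?_)
      rintro _ ⟨x, hx, rfl⟩; exact f.map_target (hs hx)

end LocallyBilipschitz

/-! ### Geometry of the tube and failure of the inequality there. -/

section Tube

open Metric Set Filter

variable {H : Type*} [NormedAddCommGroup H] [InnerProductSpace ℝ H] (e : HilbertBasis ℤ ℝ H)

lemma norm_basis (j : ℤ) : ‖e j‖ = 1 := e.orthonormal.1 j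

lemma inner_basis (i j : ℤ) : inner ℝ (e i) (e j) = if i = j then (1 : ℝ) else 0 :=
  orthonormal_iff_ite.1 e.orthonormal i j

lemma mem_tube_iff {r : ℝ} {x : H} : x ∈ tube e r ↔ ∃ t : ℝ, ‖x - t • e 1‖ < r := by
  constructor
  · rintro ⟨_, ⟨t, rfl⟩, b, hb, rfl⟩
    exact ⟨t, by simpa using hb⟩
  · rintro ⟨t, ht⟩
    exact ⟨t • e 1, ⟨t, rfl⟩, x - t • e 1, by simpa using ht, by simp⟩

lemma mem_tube_iff_inner {r : ℝ} {x : H} :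
    x ∈ tube e r ↔ ‖x - (inner ℝ (e 1) x : ℝ) • e 1‖ < r := by
  rw [mem_tube_iff]
  refine ⟨fun ⟨t, ht⟩ => lt_of_le_of_lt ?_ ht, fun h => ⟨_, h⟩⟩
  set s : ℝ := inner ℝ (e 1) x with hs
  have h1 : x - t • e 1 = (x - s • e 1) + (s - t) • e 1 := by rw [sub_smul]; abel
  have h2 : inner ℝ (x - s • e 1) ((s - t) • e 1) = (0 : ℝ) := by
    rw [inner_smul_right, inner_sub_left, inner_smul_left, inner_basis, real_inner_comm, ← hs]
    simp
  have h3 := norm_add_sq_eq_norm_sq_add_norm_sq_of_inner_eq_zero _ _ h2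
  rw [← h1] at h3
  nlinarith [norm_nonneg (x - t • e 1), norm_nonneg (x - s • e 1), norm_nonneg ((s - t) • e 1)]

lemma isOpen_tube (r : ℝ) : IsOpen (tube e r) := isOpen_ball.add_left

lemma convex_tube (r : ℝ) : Convex ℝ (tube e r) := by
  refine Convex.add ?_ (convex_ball 0 r)
  have : axis e = (LinearMap.range (LinearMap.toSpanSingleton ℝ H (e 1)) : Set H) := by
    ext x; simp [axis]
  rw [this]
  exact Submodule.convex _

lemma isDom_tube {r : ℝ} (hr : 0 < r) : IsDom (tube e r) :=
  ⟨isOpen_tube e r, (convex_tube e r).isConnected ⟨0, (mem_tube_iff e).2 ⟨0, by simpa using hr⟩⟩⟩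

lemma smul_two_notMem_tube {r : ℝ} (hr : 0 < r) : r • e 2 ∉ tube e r := by
  rw [mem_tube_iff_inner, inner_smul_right, inner_basis]
  simp [norm_smul, norm_basis, abs_of_pos hr]

lemma tube_ne_univ {r : ℝ} (hr : 0 < r) : tube e r ≠ univ := fun h =>
  smul_two_notMem_tube e hr (h ▸ mem_univ _)

lemma ball_subset_tube (r t : ℝ) : ball (t • e 1) r ⊆ tube e r := fun x hx =>
  (mem_tube_iff e).2 ⟨t, by simpa [dist_eq_norm] using hx⟩

lemma smul_mem_tube {r : ℝ} (hr : 0 < r) (t : ℝ) : t • e 1 ∈ tube e r :=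
  ball_subset_tube e r t (mem_ball_self hr)

lemma ne_univ_of_isBounded (e : HilbertBasis ℤ ℝ H) {S : Set H} (hS : Bornology.IsBounded S) : S ≠ univ := by
  rintro rfl
  have : Nontrivial H := ⟨⟨e 0, 0, fun h => by simpa [h] using norm_basis e 0⟩⟩
  exact NormedSpace.unbounded_univ ℝ H hS

/-- A locally bilipschitz homeomorphism of a tube onto a bounded set does not satisfy the distance
ratio inequality. -/
theorem IsLocBilip.not_jIneqOn_tube [CompleteSpace H] {M r : ℝ} {f : OpenPartialHomeomorph H H}
    (hM : 1 ≤ M) (hf : IsLocBilip M f) (hr : 0 < r) (hsrc : f.source = tube e r)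
    (hbdd : Bornology.IsBounded f.target) (φ : ℝ≥0 ≃ₜ ℝ≥0) : ¬ JIneqOn φ f (tube e r) := by
  intro hJ
  obtain ⟨B, hB⟩ := isBounded_iff.1 hbdd
  obtain ⟨C, hC⟩ := hJ.exists_jDist_le (Real.log (1 + B / (r / M)))
  have hT : f '' tube e r = f.target := by rw [← hsrc, f.image_source_eq_target]
  have hne : f '' tube e r ≠ univ := hT ▸ ne_univ_of_isBounded e hbdd
  -- Axis points have boundary distance at least `r` in the tube, and their images lose at most a
  -- factor `M`.
  have hb : ∀ t : ℝ, r / M ≤ bdist (f '' tube e r) (f (t • e 1)) := fun t => by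
    refine le_trans ?_ (hf.le_bdist_image hM (isOpen_tube e r) hsrc.ge hne (smul_mem_tube e hr t))
    gcongr
    exact le_bdist (isOpen_tube e r) (tube_ne_univ e hr) (smul_mem_tube e hr t)
      (ball_subset_tube e r t)
  have hmem : ∀ t : ℝ, f (t • e 1) ∈ f.target := fun t =>
    f.map_source (hsrc ▸ smul_mem_tube e hr t)
  have key : ∀ t : ℝ, 0 ≤ t → Real.log (1 + t / r) ≤ C := fun t ht => by
    refine le_trans ?_ (hC _ (smul_mem_tube e hr 0) _ (smul_mem_tube e hr t)
      (jDist_le_of_le (by positivity) (hb 0) (hb t) (by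
        rw [← dist_eq_norm]; exact hB (hmem 0) (hmem t))))
    have hp : ∀ s : ℝ, 0 < bdist (tube e r) (s • e 1) := fun s =>
      bdist_pos (isOpen_tube e r) (tube_ne_univ e hr) (smul_mem_tube e hr s)
    have hle : bdist (tube e r) ((0 : ℝ) • e 1) ≤ r := by
      refine (bdist_le_dist (isOpen_tube e r) (smul_mem_tube e hr 0)
        (smul_two_notMem_tube e hr)).trans_eq ?_
      simp [dist_eq_norm, norm_smul, norm_basis, abs_of_pos hr]
    have hm := lt_min (hp 0) (hp t)
    refine Real.log_le_log (by positivity) ?_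
    rw [zero_smul, zero_sub, norm_neg, norm_smul, norm_basis, mul_one, Real.norm_eq_abs,
      abs_of_nonneg ht]
    rw [zero_smul] at hle hm
    gcongr
    exact (min_le_left _ _).trans hle
  -- At this `t` the bound reads `1 + exp C ≤ exp C`.
  have h1 := key (r * Real.exp C) (by positivity)
  rw [mul_div_cancel_left₀ _ hr.ne', Real.log_le_iff_le_exp (by positivity)] at h1
  linarith

end Tube

/-! ### Piecewise affine interpolation. -/

section Interpolation

open Set

variable {V : Type*} [NormedAddCommGroup V] [NormedSpace ℝ V]

/-- The piecewise affine interpolation of a two-sided sequence. -/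
def interp (h : ℤ → V) (t : ℝ) : V := h ⌊t⌋ + Int.fract t • (h (⌊t⌋ + 1) - h ⌊t⌋)

/-- Both ends of the cell are allowed, so that estimates on adjacent cells can be joined at the
node. -/
lemma interp_eq (h : ℤ → V) {t : ℝ} {n : ℤ} (h1 : (n : ℝ) ≤ t) (h2 : t ≤ n + 1) :
    interp h t = h n + (t - n) • (h (n + 1) - h n) := by
  rcases h2.lt_or_eq with h2 | rfl
  · have : ⌊t⌋ = n := Int.floor_eq_iff.2 ⟨h1, h2⟩
    rw [interp, Int.fract, this]
  · have : ⌊(n : ℝ) + 1⌋ = n + 1 := by simp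
    rw [interp, this]
    simp

/-- Parameters at distance at most `1` lie in one cell or in two adjacent ones, split at `⌊t⌋`. -/
lemma norm_interp_sub_le {h : ℤ → V} {C : ℝ} (hC : ∀ n, ‖h (n + 1) - h n‖ ≤ C) {s t : ℝ}
    (hst : |t - s| ≤ 1) : ‖interp h t - interp h s‖ ≤ C * |t - s| := by
  wlog hle : s ≤ t generalizing s t
  · rw [norm_sub_rev, abs_sub_comm]
    exact this (by rwa [abs_sub_comm]) (le_of_not_ge hle)
  rw [abs_of_nonneg (by linarith)] at hst ⊢
  have cell : ∀ (n : ℤ) (a b : ℝ), (n : ℝ) ≤ a → a ≤ b → b ≤ n + 1 →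
      ‖interp h b - interp h a‖ ≤ C * (b - a) := by
    intro n a b ha hab hb
    rw [interp_eq h ha (hab.trans hb), interp_eq h (ha.trans hab) hb, add_sub_add_left_eq_sub,
      ← sub_smul, sub_sub_sub_cancel_right, norm_smul, Real.norm_eq_abs,
      abs_of_nonneg (by linarith), mul_comm]
    exact mul_le_mul_of_nonneg_right (hC n) (by linarith)
  have f1 := Int.floor_le t
  have f2 := (Int.lt_floor_add_one t).le
  rcases le_total (⌊t⌋ : ℝ) s with hs | hs
  · exact cell ⌊t⌋ s t hs hle f2
  · have c1 := cell ⌊t⌋ ⌊t⌋ t le_rfl f1 f2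
    have c2 := cell (⌊t⌋ - 1) s ⌊t⌋ (by push_cast; linarith) hs (by push_cast; linarith)
    have := norm_sub_le_norm_sub_add_norm_sub (interp h t) (interp h ⌊t⌋) (interp h s)
    linarith

lemma continuous_interp {h : ℤ → V} {C : ℝ} (hC : ∀ n, ‖h (n + 1) - h n‖ ≤ C) :
    Continuous (interp h) := by
  rw [Metric.continuous_iff]
  have hC0 : 0 ≤ C := (norm_nonneg _).trans (hC 0)
  intro t ε hε
  refine ⟨min 1 (ε / (C + 1)), by positivity, fun s hs => ?_⟩
  rw [dist_eq_norm, Real.norm_eq_abs, lt_min_iff] at hs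
  rw [dist_eq_norm]
  refine (norm_interp_sub_le hC hs.1.le).trans_lt ?_
  rw [lt_div_iff₀ (by linarith)] at hs
  nlinarith [abs_nonneg (s - t)]

lemma norm_interp_le {h : ℤ → V} {C : ℝ} (hC : ∀ n, ‖h n‖ ≤ C) (t : ℝ) : ‖interp h t‖ ≤ C := by
  have f1 := Int.fract_nonneg t
  have f2 := (Int.fract_lt_one t).le
  rw [interp, show h ⌊t⌋ + Int.fract t • (h (⌊t⌋ + 1) - h ⌊t⌋)
    = (1 - Int.fract t) • h ⌊t⌋ + Int.fract t • h (⌊t⌋ + 1) by module]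
  refine (norm_add_le _ _).trans ?_
  rw [norm_smul, norm_smul, Real.norm_eq_abs, Real.norm_eq_abs, abs_of_nonneg f1,
    abs_of_nonneg (by linarith : 0 ≤ 1 - Int.fract t)]
  have h1 := mul_le_mul_of_nonneg_left (hC ⌊t⌋) (by linarith : 0 ≤ 1 - Int.fract t)
  have h2 := mul_le_mul_of_nonneg_left (hC (⌊t⌋ + 1)) f1
  linarith

end Interpolation

/-! ### Isometric frames along the broken line. -/

section Frames

variable {H : Type*} [NormedAddCommGroup H] [InnerProductSpace ℝ H]

open scoped RealInnerProductSpace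

/-- The quarter turn in an oriented plane, extended by the identity. -/
lemma exists_quarterTurn {a b : H} (ha : ‖a‖ = 1) (hb : ‖b‖ = 1) (hab : ⟪a, b⟫ = 0) :
    ∃ J : H ≃ₗᵢ[ℝ] H, ∀ x, J x = x - (⟪a, x⟫ + ⟪b, x⟫) • a + (⟪a, x⟫ - ⟪b, x⟫) • b := by
  have haa : ⟪a, a⟫ = 1 := by rw [real_inner_self_eq_norm_sq, ha]; norm_num
  have hbb : ⟪b, b⟫ = 1 := by rw [real_inner_self_eq_norm_sq, hb]; norm_num
  have hba : ⟪b, a⟫ = 0 := by rw [real_inner_comm]; exact hab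
  let J₁ : H →ₗ[ℝ] H :=
    { toFun := fun x => x - (⟪a, x⟫ + ⟪b, x⟫) • a + (⟪a, x⟫ - ⟪b, x⟫) • b
      map_add' := fun x y => by simp only [inner_add_right]; module
      map_smul' := fun c x => by simp only [inner_smul_right, RingHom.id_apply]; module }
  -- `J₁` sends `a` to `b` and `b` to `-a`; this is the opposite turn.
  let J₂ : H →ₗ[ℝ] H :=
    { toFun := fun x => x + (⟪b, x⟫ - ⟪a, x⟫) • a - (⟪a, x⟫ + ⟪b, x⟫) • b
      map_add' := fun x y => by simp only [inner_add_right]; module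
      map_smul' := fun c x => by simp only [inner_smul_right, RingHom.id_apply]; module }
  have e₁ : ∀ x, J₁ x = x - (⟪a, x⟫ + ⟪b, x⟫) • a + (⟪a, x⟫ - ⟪b, x⟫) • b := fun _ => rfl
  have e₂ : ∀ x, J₂ x = x + (⟪b, x⟫ - ⟪a, x⟫) • a - (⟪a, x⟫ + ⟪b, x⟫) • b := fun _ => rfl
  have h₁₂ : J₁ ∘ₗ J₂ = LinearMap.id := by
    ext x
    simp only [LinearMap.comp_apply, e₁, e₂, inner_add_right, inner_sub_right, inner_smul_right,
      haa, hbb, hab, hba, LinearMap.id_apply]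
    module
  have h₂₁ : J₂ ∘ₗ J₁ = LinearMap.id := by
    ext x
    simp only [LinearMap.comp_apply, e₁, e₂, inner_add_right, inner_sub_right, inner_smul_right,
      haa, hbb, hab, hba, LinearMap.id_apply]
    module
  refine ⟨⟨LinearEquiv.ofLinearMap J₁ J₂ h₁₂ h₂₁, fun x => ?_⟩, fun x => rfl⟩
  rw [LinearEquiv.coe_ofLinearMap, ← sq_eq_sq₀ (norm_nonneg _) (norm_nonneg _),
    ← real_inner_self_eq_norm_sq, ← real_inner_self_eq_norm_sq, e₁]
  simp only [inner_add_right, inner_sub_right, inner_smul_right, inner_add_left, inner_sub_left,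
    inner_smul_left, haa, hbb, hab, hba, real_inner_comm a x, real_inner_comm b x,
    RCLike.conj_to_real]
  ring

/-- The shift of a Hilbert basis that is indexed by the integers. -/
lemma exists_shift [CompleteSpace H] (e : HilbertBasis ℤ ℝ H) :
    ∃ S : H ≃ₗᵢ[ℝ] H, ∀ j, S (e j) = e (j + 1) := by
  have ho : Orthonormal ℝ fun j : ℤ => e (j + 1) :=
    e.orthonormal.comp _ (add_left_injective 1)
  have hr : Set.range (fun j : ℤ => e (j + 1)) = Set.range e := by
    ext x
    constructor
    · rintro ⟨j, rfl⟩; exact ⟨_, rfl⟩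
    · rintro ⟨j, rfl⟩; exact ⟨j - 1, by simp⟩
  let e' : HilbertBasis ℤ ℝ H := HilbertBasis.mk ho (by rw [hr, e.dense_span])
  refine ⟨e.repr.trans e'.repr.symm, fun j => ?_⟩
  rw [LinearIsometryEquiv.trans_apply, e.repr_self, e'.repr_symm_single]
  simp [e']

/-- The direction of the broken line at its vertex `e n`. -/
def cornerDir (e : HilbertBasis ℤ ℝ H) (n : ℤ) : H := e (n + 1) - e (n - 1)

/-- Frames `T n` along the vertices of the broken line: `T n` maps the orthogonal complement of
`e 1` onto the hyperplane normal to the broken line at `e n`, and consecutive frames are related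
by a quarter turn. -/
structure IsFrameSeq (e : HilbertBasis ℤ ℝ H) (T : ℤ → H ≃ₗᵢ[ℝ] H) : Prop where
  inner_dir : ∀ n v, ⟪e 1, v⟫ = 0 → ⟪cornerDir e n, T n v⟫ = 0
  inner_nonneg : ∀ n v, 0 ≤ ⟪T n v, T (n + 1) v⟫
  -- In the interpolated inner product the two mixed terms share the coefficient `θ (1 - θ)`, so
  -- only their sum has to vanish.
  inner_cross : ∀ n v, ⟪e 1, v⟫ = 0 →
    ⟪cornerDir e n, T (n + 1) v⟫ + ⟪cornerDir e (n + 1), T n v⟫ = 0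
  surj : ∀ n (θ : ℝ) z, ⟪(1 - θ) • cornerDir e n + θ • cornerDir e (n + 1), z⟫ = 0 →
    ∃ v, ⟪e 1, v⟫ = 0 ∧ (1 - θ) • T n v + θ • T (n + 1) v = z

lemma mul_isometry_apply (P Q : H ≃ₗᵢ[ℝ] H) (x : H) : (P * Q) x = P (Q x) := rfl

lemma zpow_apply_eq_self {Q : H ≃ₗᵢ[ℝ] H} {a : H} (h : Q a = a) (n : ℤ) : (Q ^ n) a = a := by
  have h' : Q⁻¹ a = a := by
    have : Q⁻¹ (Q a) = a := Q.symm_apply_apply a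
    rwa [h] at this
  induction n using Int.induction_on with
  | zero => simp
  | succ n ih => rw [zpow_add_one, mul_isometry_apply, h, ih]
  | pred n ih => rw [zpow_sub_one, mul_isometry_apply, h', ih]

lemma shift_zpow_apply {e : HilbertBasis ℤ ℝ H} {S : H ≃ₗᵢ[ℝ] H} (hS : ∀ j, S (e j) = e (j + 1))
    (n j : ℤ) : (S ^ n) (e j) = e (j + n) := by
  have h' : ∀ j, S⁻¹ (e j) = e (j - 1) := fun j => by
    have : S⁻¹ (S (e (j - 1))) = e (j - 1) := S.symm_apply_apply _
    rwa [hS, sub_add_cancel] at this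
  induction n using Int.induction_on generalizing j with
  | zero => simp
  | succ n ih => rw [zpow_add_one, mul_isometry_apply, hS, ih]; congr 1; ring
  | pred n ih => rw [zpow_sub_one, mul_isometry_apply, h', ih]; congr 1; ring

/-- Let `S` be the shift, `a` and `b = S a` the orthogonal unit corner directions at `0` and `1`,
`J` the quarter turn from `a` to `b`, and `U` an isometry with `U (e 1) = a`. Then `Q = S⁻¹ J` fixes
`a`, and `T n = Sⁿ Qⁿ U` works: as `S Q = J`, the frame `T (n + 1)` is `Sⁿ J Qⁿ U`. Applying `S⁻ⁿ`
reduces each property to comparing `x` with `J x`, and `x ⊥ a` when the vector is normal to `e 1`.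
-/
lemma exists_isFrameSeq [CompleteSpace H] (e : HilbertBasis ℤ ℝ H) :
    ∃ T : ℤ → H ≃ₗᵢ[ℝ] H, IsFrameSeq e T := by
  obtain ⟨S, hS⟩ := exists_shift e
  have h2p : 0 < (√2 : ℝ) := by positivity
  have hdirS : ∀ n, S (cornerDir e n) = cornerDir e (n + 1) := fun n => by
    rw [cornerDir, cornerDir, map_sub, hS, hS]; congr 2; ring
  have hdirn : ∀ n, (S ^ n) (cornerDir e 0) = cornerDir e n := fun n => by
    rw [cornerDir, cornerDir, map_sub, shift_zpow_apply hS, shift_zpow_apply hS]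
    congr 2 <;> ring
  have hdd : ∀ n, ⟪cornerDir e n, cornerDir e n⟫ = 2 := fun n => by
    simp only [cornerDir, inner_sub_left, inner_sub_right, inner_basis]
    rw [if_neg (by omega : ¬n - 1 = n + 1), if_neg (by omega : ¬n + 1 = n - 1)]
    norm_num
  have hd1 : ⟪cornerDir e 0, cornerDir e 1⟫ = 0 := by
    simp [cornerDir, inner_sub_left, inner_sub_right, inner_basis]
  set a := (√2)⁻¹ • cornerDir e 0 with ha
  set b := (√2)⁻¹ • cornerDir e 1 with hb
  have hnorm : ∀ n, ‖(√2)⁻¹ • cornerDir e n‖ = 1 := fun n => by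
    have : ‖cornerDir e n‖ ^ 2 = 2 := by rw [← real_inner_self_eq_norm_sq, hdd]
    rw [norm_smul, norm_inv, Real.norm_of_nonneg h2p.le, ← this, Real.sqrt_sq (norm_nonneg _),
      inv_mul_cancel₀]
    intro h
    rw [h] at this
    norm_num at this
  have hab : ⟪a, b⟫ = 0 := by rw [ha, hb, inner_smul_left, inner_smul_right, hd1]; simp
  have haa : ⟪a, a⟫ = 1 := by rw [real_inner_self_eq_norm_sq, hnorm]; norm_num
  have hbb : ⟪b, b⟫ = 1 := by rw [real_inner_self_eq_norm_sq, hnorm]; norm_num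
  have hba : ⟪b, a⟫ = 0 := by rw [real_inner_comm]; exact hab
  have hd0a : cornerDir e 0 = √2 • a := by rw [ha, smul_inv_smul₀ h2p.ne']
  have hd1b : cornerDir e 1 = √2 • b := by rw [hb, smul_inv_smul₀ h2p.ne']
  obtain ⟨J, hJ⟩ := exists_quarterTurn (a := a) (b := b) (hnorm 0) (hnorm 1) hab
  have hJa : J a = b := by
    rw [hJ, haa, hba]; simp
  have hSa : S a = b := by rw [ha, map_smul, hdirS]; rfl
  have hQa : (S⁻¹ * J) a = a := by
    rw [mul_isometry_apply, hJa, ← hSa]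
    exact S.symm_apply_apply a
  obtain ⟨U, hU⟩ : ∃ U : H ≃ₗᵢ[ℝ] H, U (e 1) = a :=
    ⟨_, Submodule.reflection_sub ((norm_basis e 1).trans (hnorm 0).symm)⟩
  set Q := S⁻¹ * J with hQ
  have hT1 : ∀ (n : ℤ) v, (S ^ (n + 1) * Q ^ (n + 1) * U) v = (S ^ n) (J ((Q ^ n) (U v))) := by
    intro n v
    have : S ^ (n + 1) * Q ^ (n + 1) * U = S ^ n * (J * (Q ^ n * U)) := by
      have hJQ : J = S * Q := by rw [hQ, mul_inv_cancel_left]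
      rw [hJQ, zpow_add_one S, add_comm n 1, zpow_add Q, zpow_one]
      simp only [mul_assoc]
    rw [this]
    rfl
  have hT0 : ∀ (n : ℤ) v, (S ^ n * Q ^ n * U) v = (S ^ n) ((Q ^ n) (U v)) := fun n v => rfl
  have hdn1 : ∀ n : ℤ, (S ^ n) (cornerDir e 1) = cornerDir e (n + 1) := fun n => by
    rw [← hdirn (n + 1), zpow_add_one, mul_isometry_apply, hdirS]; rfl
  have hperp : ∀ (n : ℤ) v, ⟪e 1, v⟫ = 0 → ⟪a, (Q ^ n) (U v)⟫ = 0 := fun n v hv => by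
    rw [← zpow_apply_eq_self hQa n, LinearIsometryEquiv.inner_map_map, ← hU,
      LinearIsometryEquiv.inner_map_map, hv]
  refine ⟨fun n => S ^ n * Q ^ n * U, ?_, ?_, ?_, ?_⟩
  · intro n v hv
    rw [hT0, ← hdirn n, LinearIsometryEquiv.inner_map_map, hd0a, inner_smul_left, hperp n v hv]
    simp
  · intro n v
    rw [hT0, hT1, LinearIsometryEquiv.inner_map_map, hJ]
    set w := (Q ^ n) (U v)
    simp only [inner_add_right, inner_sub_right, inner_smul_right, real_inner_comm a w,
      real_inner_comm b w]
    -- `⟪w, J w⟫` is the squared norm of the component of `w` orthogonal to `a` and `b`.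
    have h0 : 0 ≤ ⟪w - ⟪a, w⟫ • a - ⟪b, w⟫ • b, w - ⟪a, w⟫ • a - ⟪b, w⟫ • b⟫ :=
      real_inner_self_nonneg
    simp only [inner_sub_right, inner_smul_right, inner_sub_left, inner_smul_left, haa, hbb, hab,
      hba, real_inner_comm a w, real_inner_comm b w, RCLike.conj_to_real] at h0
    nlinarith
  · intro n v hv
    rw [hT1, hT0, ← hdirn n, ← hdn1 n, LinearIsometryEquiv.inner_map_map,
      LinearIsometryEquiv.inner_map_map, hJ, hd0a, hd1b]
    simp only [inner_add_right, inner_sub_right, inner_smul_right, inner_smul_left, haa, hab,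
      hperp n v hv, RCLike.conj_to_real]
    ring
  · intro n θ z hz
    obtain ⟨y, rfl⟩ : ∃ y, (S ^ n) y = z := ⟨_, (S ^ n).apply_symm_apply z⟩
    rw [← hdirn n, ← hdn1 n, ← map_smul, ← map_smul, ← map_add,
      LinearIsometryEquiv.inner_map_map, hd0a, hd1b] at hz
    simp only [inner_add_left, inner_smul_left, RCLike.conj_to_real] at hz
    set α := ⟪a, y⟫ with hα
    set β := ⟪b, y⟫ with hβ
    have hz' : (1 - θ) * α + θ * β = 0 := by
      have : √2 * ((1 - θ) * α + θ * β) = 0 := by linear_combination hz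
      exact (mul_eq_zero.1 this).resolve_left h2p.ne'
    set D := (1 - θ) ^ 2 + θ ^ 2 with hD
    have hD0 : 0 < D := by nlinarith [sq_nonneg (1 - θ - θ)]
    -- On the plane of `a` and `b` the unknown is `β' • b`, with `(1 - θ) β' = β` and `-θ β' = α`.
    -- These are compatible by `hz'`, and this form of the solution avoids dividing by `θ` or `1 -
    -- θ`.
    set β' := (-θ * α + (1 - θ) * β) / D with hβ'
    have k1 : θ * β' = -α := by
      rw [hβ']; field_simp; rw [hD]; linear_combination (1 - θ) * hz'
    have k2 : (1 - θ) * β' = β := by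
      rw [hβ']; field_simp; rw [hD]; linear_combination -θ * hz'
    set x := y - α • a + (β' - β) • b with hx
    have xa : ⟪a, x⟫ = 0 := by
      simp only [hx, inner_add_right, inner_sub_right, inner_smul_right, haa, hab]
      rw [← hα]; ring
    have xb : ⟪b, x⟫ = β' := by
      simp only [hx, inner_add_right, inner_sub_right, inner_smul_right, hbb, hba]
      rw [← hβ]; ring
    obtain ⟨v, hv⟩ : ∃ v, (Q ^ n) (U v) = x :=
      ⟨U.symm ((Q ^ n).symm x), by rw [U.apply_symm_apply, (Q ^ n).apply_symm_apply]⟩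
    refine ⟨v, ?_, ?_⟩
    · rw [← U.inner_map_map, ← (Q ^ n).inner_map_map, hU, zpow_apply_eq_self hQa, hv, xa]
    · rw [hT0, hT1, hv, hJ, xa, xb, ← map_smul, ← map_smul, ← map_add]
      congr 1
      have : (1 - θ) • x + θ • (x - (0 + β') • a + (0 - β') • b)
          = y + (-α - θ * β') • a + ((1 - θ) * β' - β) • b := by
        rw [hx]; module
      rw [this, k1, k2]
      simp

end Frames

/-! ### The bending map: bilipschitz bounds, injectivity, openness. -/

section BrokenLine

open Set

variable {H : Type*} [NormedAddCommGroup H] [InnerProductSpace ℝ H]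

open scoped RealInnerProductSpace

lemma norm_basis_sub_le (e : HilbertBasis ℤ ℝ H) (i j : ℤ) : ‖e i - e j‖ ≤ 2 := by
  refine (norm_sub_le _ _).trans ?_
  rw [norm_basis, norm_basis]
  norm_num

lemma abs_inner_le_two_mul {x y : H} (hx : ‖x‖ ≤ 2) : |⟪x, y⟫| ≤ 2 * ‖y‖ :=
  (abs_real_inner_le_norm x y).trans (mul_le_mul_of_nonneg_right hx (norm_nonneg _))

lemma inner_interp_cornerDir (e : HilbertBasis ℤ ℝ H) (n j : ℤ) {t : ℝ} (h1 : (n : ℝ) ≤ t)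
    (h2 : t ≤ n + 1) : ⟪interp (cornerDir e) t, e j⟫
      = (1 - (t - n)) * ((if n + 1 = j then 1 else 0) - if n - 1 = j then 1 else 0)
        + (t - n) * ((if n + 2 = j then 1 else 0) - if n = j then 1 else 0) := by
  rw [interp_eq _ h1 h2, cornerDir, cornerDir, add_sub_cancel_right,
    show n + 1 + 1 = n + 2 by ring]
  simp only [inner_add_left, inner_sub_left, inner_smul_left, inner_basis, RCLike.conj_to_real]
  ring

/-- Put `θ = t - ⌊t⌋`. Paired with the direction at `t`, the broken line has slope `1` on the cell
of `t`, `1 - 2θ` on the previous cell and `2θ - 1` on the next. The neighbouring cells are reached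
only if `θ ≤ 1/4`, respectively `θ ≥ 3/4`, so all slopes that occur are at least `1/2`. -/
lemma half_le_inner_interp_cornerDir (e : HilbertBasis ℤ ℝ H) {s t : ℝ} (hst : |t - s| ≤ 1 / 4) :
    (t - s) ^ 2 / 2 ≤ (t - s) * ⟪interp (cornerDir e) t, interp e t - interp e s⟫ := by
  set n := ⌊t⌋ with hn
  have f1 := Int.floor_le t
  have f2 := (Int.lt_floor_add_one t).le
  rw [← hn] at f1 f2
  rw [abs_le] at hst
  have p0 := inner_interp_cornerDir e n (n - 1) f1 f2
  have p1 := inner_interp_cornerDir e n n f1 f2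
  have p2 := inner_interp_cornerDir e n (n + 1) f1 f2
  have p3 := inner_interp_cornerDir e n (n + 2) f1 f2
  simp only [if_neg (by omega : ¬n + 1 = n - 1), if_neg (by omega : ¬n + 2 = n - 1),
    if_neg (by omega : ¬n = n - 1), if_true] at p0
  simp only [if_neg (by omega : ¬n + 1 = n), if_neg (by omega : ¬n + 2 = n),
    if_neg (by omega : ¬n - 1 = n), if_true] at p1
  simp only [if_neg (by omega : ¬n - 1 = n + 1), if_neg (by omega : ¬n + 2 = n + 1),
    if_neg (by omega : ¬n = n + 1), if_true] at p2
  simp only [if_neg (by omega : ¬n - 1 = n + 2), if_neg (by omega : ¬n + 1 = n + 2),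
    if_neg (by omega : ¬n = n + 2), if_true] at p3
  set N := interp (cornerDir e) t
  have et : ⟪N, interp e t⟫ = ⟪N, e n⟫ + (t - n) * (⟪N, e (n + 1)⟫ - ⟪N, e n⟫) := by
    rw [interp_eq _ f1 f2, inner_add_right, inner_smul_right, inner_sub_right]
  rw [inner_sub_right, et]
  rcases le_total s n with h | h
  · have es : ⟪N, interp e s⟫ = ⟪N, e (n - 1)⟫ + (s - (n - 1)) * (⟪N, e n⟫ - ⟪N, e (n - 1)⟫) := by
      have h1 : ((n - 1 : ℤ) : ℝ) ≤ s := by push_cast; linarith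
      have h2 : s ≤ ((n - 1 : ℤ) : ℝ) + 1 := by push_cast; linarith
      rw [interp_eq _ h1 h2, inner_add_right, inner_smul_right, inner_sub_right,
        sub_add_cancel]
      push_cast
      ring
    rw [es, p0, p1, p2]
    nlinarith [mul_nonneg (sub_nonneg.2 h) (sub_nonneg.2 (h.trans f1)),
      mul_nonneg (mul_nonneg (sub_nonneg.2 h) (sub_nonneg.2 (h.trans f1)))
        (by linarith : 0 ≤ 1 / 4 - (t - n))]
  rcases le_total s (n + 1) with h' | h'
  · have es : ⟪N, interp e s⟫ = ⟪N, e n⟫ + (s - n) * (⟪N, e (n + 1)⟫ - ⟪N, e n⟫) := by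
      rw [interp_eq _ h h', inner_add_right, inner_smul_right, inner_sub_right]
    rw [es, p1, p2]
    nlinarith [sq_nonneg (t - s)]
  · have es : ⟪N, interp e s⟫
        = ⟪N, e (n + 1)⟫ + (s - (n + 1)) * (⟪N, e (n + 2)⟫ - ⟪N, e (n + 1)⟫) := by
      have h1 : ((n + 1 : ℤ) : ℝ) ≤ s := by push_cast; linarith
      have h2 : s ≤ ((n + 1 : ℤ) : ℝ) + 1 := by push_cast; linarith
      rw [interp_eq _ h1 h2, inner_add_right, inner_smul_right, inner_sub_right,
        show n + 1 + 1 = n + 2 by ring]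
      push_cast
      ring
    rw [es, p1, p2, p3]
    nlinarith [mul_nonneg (sub_nonneg.2 h') (sub_nonneg.2 (f2.trans h')),
      mul_nonneg (mul_nonneg (sub_nonneg.2 h') (sub_nonneg.2 (f2.trans h')))
        (by linarith : 0 ≤ 1 / 4 - (n + 1 - t))]

/-- Functionals of norm at most `2` separate the points: `e n + e (n + 1)` is `1` on the cell of `t`
and `0` on cells two or more before it, while `cornerDir e n` takes the value `u - n` at every
parameter `u` in `[n - 1, n + 1]`. -/
lemma eighth_le_norm_interp_sub (e : HilbertBasis ℤ ℝ H) {s t : ℝ} (hst : 1 / 4 ≤ |t - s|) :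
    1 / 8 ≤ ‖interp e t - interp e s‖ := by
  wlog hle : s ≤ t generalizing s t
  · rw [norm_sub_rev]
    exact this (by rwa [abs_sub_comm]) (le_of_not_ge hle)
  rw [abs_of_nonneg (by linarith)] at hst
  set n := ⌊t⌋ with hn
  have f1 := Int.floor_le t
  have f2 := (Int.lt_floor_add_one t).le
  rw [← hn] at f1 f2
  rcases lt_or_ge s (n - 1) with h | h
  · have g1 := Int.floor_le s
    have g2 := (Int.lt_floor_add_one s).le
    set m := ⌊s⌋ with hm
    have hmn : m + 1 ≤ n - 1 := by
      have : (m : ℝ) < ((n - 1 : ℤ) : ℝ) := by push_cast; linarith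
      have := Int.cast_lt.1 this
      omega
    have i1 : ⟪e n + e (n + 1), interp e t⟫ = 1 := by
      rw [interp_eq _ f1 f2]
      simp only [inner_add_right, inner_smul_right, inner_sub_right, inner_add_left, inner_basis,
        if_neg (by omega : ¬n + 1 = n), if_neg (by omega : ¬n = n + 1), if_true]
      ring
    have i2 : ⟪e n + e (n + 1), interp e s⟫ = 0 := by
      rw [interp_eq _ g1 g2]
      simp only [inner_add_right, inner_smul_right, inner_sub_right, inner_add_left, inner_basis,
        if_neg (by omega : ¬n = m), if_neg (by omega : ¬n = m + 1), if_neg (by omega : ¬n + 1 = m),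
        if_neg (by omega : ¬n + 1 = m + 1)]
      ring
    have hb : ‖e n + e (n + 1)‖ ≤ 2 := by
      refine (norm_add_le _ _).trans ?_
      rw [norm_basis, norm_basis]; norm_num
    have := abs_inner_le_two_mul (y := interp e t - interp e s) hb
    rw [inner_sub_right, i1, i2, sub_zero, abs_one] at this
    linarith
  · have q0 : ⟪cornerDir e n, e (n - 1)⟫ = -1 := by
      simp only [cornerDir, inner_sub_left, inner_basis, if_neg (by omega : ¬n + 1 = n - 1),
        if_true]
      norm_num
    have q1 : ⟪cornerDir e n, e n⟫ = 0 := by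
      simp only [cornerDir, inner_sub_left, inner_basis, if_neg (by omega : ¬n + 1 = n),
        if_neg (by omega : ¬n - 1 = n)]
      norm_num
    have q2 : ⟪cornerDir e n, e (n + 1)⟫ = 1 := by
      simp only [cornerDir, inner_sub_left, inner_basis, if_neg (by omega : ¬n - 1 = n + 1),
        if_true]
      norm_num
    have i1 : ∀ u : ℝ, (n : ℝ) ≤ u → u ≤ n + 1 → ⟪cornerDir e n, interp e u⟫ = u - n := by
      intro u h1 h2
      rw [interp_eq _ h1 h2, inner_add_right, inner_smul_right, inner_sub_right, q1, q2]
      ring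
    have i2 : ⟪cornerDir e n, interp e s⟫ = s - n := by
      rcases le_total s n with h' | h'
      · have h1 : ((n - 1 : ℤ) : ℝ) ≤ s := by push_cast; linarith
        have h2 : s ≤ ((n - 1 : ℤ) : ℝ) + 1 := by push_cast; linarith
        rw [interp_eq _ h1 h2, inner_add_right, inner_smul_right, inner_sub_right,
          sub_add_cancel, q0, q1]
        push_cast
        ring
      · exact i1 s h' (hle.trans f2)
    have := abs_inner_le_two_mul (y := interp e t - interp e s)
      (norm_basis_sub_le e (n + 1) (n - 1))
    have hd : e (n + 1) - e (n - 1) = cornerDir e n := rfl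
    rw [hd, inner_sub_right, i1 t f1 f2, i2, sub_sub_sub_cancel_right,
      abs_of_nonneg (by linarith)] at this
    linarith

lemma norm_cornerDir_sub_le (e : HilbertBasis ℤ ℝ H) (n : ℤ) :
    ‖cornerDir e (n + 1) - cornerDir e n‖ ≤ 4 := by
  refine (norm_sub_le _ _).trans ?_
  have h1 : ‖cornerDir e (n + 1)‖ ≤ 2 := norm_basis_sub_le e _ _
  have h2 : ‖cornerDir e n‖ ≤ 2 := norm_basis_sub_le e _ _
  linarith

/-- The map onto a neighborhood of the broken line: the frame at each point of the broken line is
interpolated between the frames at the adjacent vertices. -/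
def bend (e : HilbertBasis ℤ ℝ H) (T : ℤ → H ≃ₗᵢ[ℝ] H) (t : ℝ) (v : H) : H :=
  interp e t + interp (fun n => T n v) t

section Frame

variable (e : HilbertBasis ℤ ℝ H) {T : ℤ → H ≃ₗᵢ[ℝ] H}

lemma frame_sub (T : ℤ → H ≃ₗᵢ[ℝ] H) (t : ℝ) (v w : H) :
    interp (fun n => T n (v - w)) t = interp (fun n => T n v) t - interp (fun n => T n w) t := by
  simp only [interp, map_sub]
  module

lemma norm_frame_le (T : ℤ → H ≃ₗᵢ[ℝ] H) (t : ℝ) (v : H) : ‖interp (fun n => T n v) t‖ ≤ ‖v‖ :=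
  norm_interp_le (fun n => ((T n).norm_map v).le) t

lemma norm_frame_sub_le (T : ℤ → H ≃ₗᵢ[ℝ] H) {s t : ℝ} (hst : |t - s| ≤ 1) (v : H) :
    ‖interp (fun n => T n v) t - interp (fun n => T n v) s‖ ≤ 2 * ‖v‖ * |t - s| := by
  refine norm_interp_sub_le (fun n => (norm_sub_le _ _).trans ?_) hst
  rw [(T _).norm_map, (T _).norm_map, two_mul]

lemma norm_interp_cornerDir_le (t : ℝ) : ‖interp (cornerDir e) t‖ ≤ 2 :=
  norm_interp_le (fun _ => norm_basis_sub_le e _ _) t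

variable {e}

lemma IsFrameSeq.inner_frame (hT : IsFrameSeq e T) (t : ℝ) {v : H} (hv : ⟪e 1, v⟫ = 0) :
    ⟪interp (cornerDir e) t, interp (fun n => T n v) t⟫ = 0 := by
  have h1 := hT.inner_dir ⌊t⌋ v hv
  have h2 := hT.inner_dir (⌊t⌋ + 1) v hv
  have h3 := hT.inner_cross ⌊t⌋ v hv
  simp only [interp, inner_add_left, inner_add_right, inner_sub_left, inner_sub_right,
    inner_smul_left, inner_smul_right, RCLike.conj_to_real]
  rw [h1, h2]
  linear_combination (Int.fract t - Int.fract t ^ 2) * h3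

/-- Consecutive frames never make an obtuse angle at `v`, so the convex combination cannot collapse:
its squared norm is at least `((1 - θ)² + θ²) ‖v‖²`. -/
lemma IsFrameSeq.norm_le (hT : IsFrameSeq e T) (t : ℝ) (v : H) :
    ‖v‖ ≤ 2 * ‖interp (fun n => T n v) t‖ := by
  have h1 := hT.inner_nonneg ⌊t⌋ v
  have f1 := Int.fract_nonneg t
  have f2 := (Int.fract_lt_one t).le
  set θ := Int.fract t with hθ
  have h2 : ‖interp (fun n => T n v) t‖ ^ 2
      = ((1 - θ) ^ 2 + θ ^ 2) * ‖v‖ ^ 2 + 2 * (θ * (1 - θ)) * ⟪T ⌊t⌋ v, T (⌊t⌋ + 1) v⟫ := by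
    rw [← real_inner_self_eq_norm_sq]
    simp only [interp, inner_add_left, inner_add_right, inner_sub_left, inner_sub_right,
      inner_smul_left, inner_smul_right, RCLike.conj_to_real,
      real_inner_comm (T ⌊t⌋ v) (T (⌊t⌋ + 1) v), real_inner_self_eq_norm_sq,
      LinearIsometryEquiv.norm_map]
    rw [← hθ]
    ring
  have h3 : 0 ≤ 2 * (θ * (1 - θ)) * ⟪T ⌊t⌋ v, T (⌊t⌋ + 1) v⟫ :=
    mul_nonneg (mul_nonneg zero_le_two (mul_nonneg f1 (by linarith))) h1
  have h4 : 1 / 4 ≤ (1 - θ) ^ 2 + θ ^ 2 := by nlinarith [sq_nonneg (1 - 2 * θ)]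
  have h5 := mul_le_mul_of_nonneg_right h4 (sq_nonneg ‖v‖)
  refine le_of_sq_le_sq ?_ (by positivity)
  rw [mul_pow]
  linarith

lemma IsFrameSeq.exists_frame_eq (hT : IsFrameSeq e T) (t : ℝ) {z : H}
    (hz : ⟪interp (cornerDir e) t, z⟫ = 0) :
    ∃ v, ⟪e 1, v⟫ = 0 ∧ interp (fun n => T n v) t = z := by
  have conv : ∀ h : ℤ → H, interp h t
      = (1 - Int.fract t) • h ⌊t⌋ + Int.fract t • h (⌊t⌋ + 1) := fun h => by
    rw [interp]; module
  obtain ⟨v, hv, h⟩ := hT.surj ⌊t⌋ (Int.fract t) z (by rwa [← conv])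
  exact ⟨v, hv, (conv _).trans h⟩

lemma bend_sub (T : ℤ → H ≃ₗᵢ[ℝ] H) (t s : ℝ) (v w : H) : bend e T t v - bend e T s w
    = (interp e t - interp e s) + interp (fun n => T n (v - w)) t
      + (interp (fun n => T n w) t - interp (fun n => T n w) s) := by
  rw [bend, bend, frame_sub]
  abel

lemma norm_bend_sub_le {s t : ℝ} (hst : |t - s| ≤ 1) {v w : H} (hw : ‖w‖ ≤ 1 / 100) :
    ‖bend e T t v - bend e T s w‖ ≤ 3 * |t - s| + ‖v - w‖ := by
  rw [bend_sub]
  refine norm_add₃_le.trans ?_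
  have h1 := norm_interp_sub_le (fun n => norm_basis_sub_le e (n + 1) n) hst
  have h2 := norm_frame_le T t (v - w)
  have h3 := norm_frame_sub_le T hst w
  nlinarith [abs_nonneg (t - s)]

/-- Pairing the difference with the direction at `t` kills the term in `v - w`, which is normal, and
leaves the motion along the line up to the drift of the frame, at most `|t - s| / 50`. This controls
`|t - s|`, and then `IsFrameSeq.norm_le` controls `v - w`. -/
lemma IsFrameSeq.le_norm_bend_sub (hT : IsFrameSeq e T) {s t : ℝ} (hst : |t - s| ≤ 1 / 4) {v w : H}
    (hv : ⟪e 1, v⟫ = 0) (hw : ⟪e 1, w⟫ = 0) (hw' : ‖w‖ ≤ 1 / 100) :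
    |t - s| ≤ 5 * ‖bend e T t v - bend e T s w‖ ∧
      ‖v - w‖ ≤ 24 * ‖bend e T t v - bend e T s w‖ := by
  set X := bend e T t v - bend e T s w with hX
  have hvw : ⟪e 1, v - w⟫ = 0 := by rw [inner_sub_right, hv, hw, sub_zero]
  have hXe := bend_sub (e := e) T t s v w
  rw [← hX] at hXe
  have h3 := norm_frame_sub_le T (hst.trans (by norm_num)) w
  set Y := interp (fun n => T n w) t - interp (fun n => T n w) s
  have hY : ‖Y‖ ≤ |t - s| / 50 := by nlinarith [abs_nonneg (t - s)]
  have hN := norm_interp_cornerDir_le e t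
  set N := interp (cornerDir e) t with hNdef
  have h1 := half_le_inner_interp_cornerDir e hst
  rw [← hNdef] at h1
  have h2 : ⟪N, interp e t - interp e s⟫ = ⟪N, X⟫ - ⟪N, Y⟫ := by
    rw [hXe, inner_add_right, inner_add_right, hT.inner_frame t hvw]
    ring
  have h4 := abs_inner_le_two_mul (y := X) hN
  have h5 := abs_inner_le_two_mul (y := Y) hN
  have h6 : |t - s| ^ 2 / 2 ≤ |t - s| * (2 * ‖X‖ + |t - s| / 25) := by
    rw [sq_abs]
    refine h1.trans ((le_abs_self _).trans ?_)
    rw [abs_mul, h2]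
    gcongr
    refine (abs_sub _ _).trans ?_
    linarith
  have ht : |t - s| ≤ 5 * ‖X‖ := by
    rcases (abs_nonneg (t - s)).eq_or_lt with h0 | h0
    · rw [← h0]; positivity
    · have : |t - s| / 2 ≤ 2 * ‖X‖ + |t - s| / 25 := by
        refine le_of_mul_le_mul_left ?_ h0
        linarith
      linarith
  refine ⟨ht, ?_⟩
  have h7 := hT.norm_le t (v - w)
  have h8 : interp (fun n => T n (v - w)) t = X - (interp e t - interp e s) - Y := by
    rw [hXe]; abel
  have h9 : ‖interp e t - interp e s‖ ≤ 2 * |t - s| :=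
    norm_interp_sub_le (fun n => norm_basis_sub_le e (n + 1) n) (hst.trans (by norm_num : (1 / 4 : ℝ) ≤ 1))
  rw [h8] at h7
  have h10 := norm_sub_le (X - (interp e t - interp e s)) Y
  have h11 := norm_sub_le X (interp e t - interp e s)
  linarith [norm_nonneg X]

lemma IsFrameSeq.bend_injective (hT : IsFrameSeq e T) {s t : ℝ} {v w : H}
    (hv : ⟪e 1, v⟫ = 0) (hw : ⟪e 1, w⟫ = 0) (hv' : ‖v‖ ≤ 1 / 100) (hw' : ‖w‖ ≤ 1 / 100)
    (h : bend e T t v = bend e T s w) : t = s ∧ v = w := by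
  rcases le_total |t - s| (1 / 4) with hst | hst
  · obtain ⟨h1, h2⟩ := hT.le_norm_bend_sub hst hv hw hw'
    rw [h, sub_self, norm_zero, mul_zero] at h1 h2
    exact ⟨sub_eq_zero.1 (abs_nonpos_iff.1 h1), sub_eq_zero.1 (norm_le_zero_iff.1 h2)⟩
  · exfalso
    have h1 := eighth_le_norm_interp_sub e hst
    have h2 : interp e t - interp e s
        = interp (fun n => T n w) s - interp (fun n => T n v) t := by
      rw [bend, bend] at h
      rw [sub_eq_sub_iff_add_eq_add, h, add_comm]
    rw [h2] at h1
    have h3 := norm_sub_le (interp (fun n => T n w) s) (interp (fun n => T n v) t)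
    linarith [norm_frame_le T s w, norm_frame_le T t v]

/-- A zero `t` of `ψ` puts `y` in the normal hyperplane at `interp e t`, which the frame fills. Thus
a local inverse comes from the intermediate value theorem in `t` alone. -/
lemma IsFrameSeq.exists_bend_eq (hT : IsFrameSeq e T) {s : ℝ} {w : H} (hw : ⟪e 1, w⟫ = 0)
    (hw' : ‖w‖ ≤ 1 / 100) {y : H} (hy : ‖y - bend e T s w‖ < 1 / 100) :
    ∃ t v, ⟪e 1, v⟫ = 0 ∧ bend e T t v = y ∧ |t - s| ≤ 5 * ‖y - bend e T s w‖ ∧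
      ‖v - w‖ ≤ 24 * ‖y - bend e T s w‖ := by
  set ψ : ℝ → ℝ := fun t => ⟪interp (cornerDir e) t, y - interp e t⟫ with hψ
  have hψc : Continuous ψ := (continuous_interp (norm_cornerDir_sub_le e)).inner
    (continuous_const.sub (continuous_interp fun n => norm_basis_sub_le e (n + 1) n))
  -- At distance `1/4` the motion along the line contributes at least `1/32`, the perturbations at
  -- most `3/400`.
  have key : ∀ t, |t - s| = 1 / 4 → (t - s) * ψ t < 0 := by
    intro t ht
    have h1 := half_le_inner_interp_cornerDir e ht.le
    have hN := norm_interp_cornerDir_le e t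
    set N := interp (cornerDir e) t with hNdef
    have h3 := norm_frame_sub_le T (ht.le.trans (by norm_num)) w
    set Y := interp (fun n => T n w) t - interp (fun n => T n w) s with hYdef
    have hY : ‖Y‖ ≤ 1 / 200 := by rw [ht] at h3; linarith
    have h2 : ψ t = ⟪N, y - bend e T s w⟫ - ⟪N, interp e t - interp e s⟫ - ⟪N, Y⟫ := by
      have h0 := hT.inner_frame t hw
      have : y - interp e t = (y - bend e T s w) - (interp e t - interp e s) - Y
          + interp (fun n => T n w) t := by
        rw [bend, hYdef]; abel
      simp only [hψ]
      rw [this, inner_add_right, h0, inner_sub_right, inner_sub_right, add_zero]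
    have h4 := abs_inner_le_two_mul (y := y - bend e T s w) hN
    have h5 := abs_inner_le_two_mul (y := Y) hN
    have h6 : (t - s) * (⟪N, y - bend e T s w⟫ - ⟪N, Y⟫) ≤ 1 / 4 * (2 * (1 / 100) + 2 * (1 / 200)) := by
      refine (le_abs_self _).trans ?_
      rw [abs_mul, ht]
      gcongr
      refine (abs_sub _ _).trans ?_
      linarith
    have h7 : (t - s) ^ 2 = 1 / 16 := by rw [← sq_abs, ht]; norm_num
    rw [h2]
    rw [h7] at h1
    linarith
  obtain ⟨t, ht, h0⟩ : ∃ t ∈ Icc (s - 1 / 4) (s + 1 / 4), ψ t = 0 := by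
    refine intermediate_value_Icc' (by linarith) hψc.continuousOn ⟨?_, ?_⟩
    · have := key (s + 1 / 4) (by rw [add_sub_cancel_left]; norm_num)
      rw [add_sub_cancel_left] at this
      linarith
    · have := key (s - 1 / 4) (by rw [sub_sub_cancel_left]; norm_num)
      rw [sub_sub_cancel_left] at this
      linarith
  obtain ⟨v, hv, hz⟩ := hT.exists_frame_eq t h0
  have hb : bend e T t v = y := by rw [bend, hz]; abel
  have hts : |t - s| ≤ 1 / 4 := abs_le.2 ⟨by linarith [ht.1], by linarith [ht.2]⟩
  obtain ⟨h1, h2⟩ := hT.le_norm_bend_sub hts hv hw hw'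
  rw [hb] at h1 h2
  exact ⟨t, v, hv, hb, h1, h2⟩

end Frame

end BrokenLine

/-! ### The homeomorphism from the tube to a neighborhood of the broken line. -/

section TubeMap

open Metric Set Filter

variable {H : Type*} [NormedAddCommGroup H] [InnerProductSpace ℝ H]

open scoped RealInnerProductSpace

/-- The component of `x` orthogonal to the axis. -/
def perp (e : HilbertBasis ℤ ℝ H) (x : H) : H := x - (⟪e 1, x⟫ : ℝ) • e 1

variable (e : HilbertBasis ℤ ℝ H)

lemma inner_perp (x : H) : ⟪e 1, perp e x⟫ = 0 := by
  rw [perp, inner_sub_right, inner_smul_right, inner_basis]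
  simp

lemma perp_sub (x y : H) : perp e (x - y) = perp e x - perp e y := by
  rw [perp, perp, perp, inner_sub_right]
  module

lemma norm_perp_le (x : H) : ‖perp e x‖ ≤ ‖x‖ ∧ |(⟪e 1, x⟫ : ℝ)| ≤ ‖x‖ := by
  have h1 : |(⟪e 1, x⟫ : ℝ)| ≤ ‖x‖ := by
    simpa [norm_basis] using abs_real_inner_le_norm (e 1) x
  refine ⟨?_, h1⟩
  have h2 : ⟪perp e x, (⟪e 1, x⟫ : ℝ) • e 1⟫ = (0 : ℝ) := by
    rw [inner_smul_right, real_inner_comm (e 1) (perp e x), inner_perp, mul_zero]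
  have h3 := norm_add_sq_eq_norm_sq_add_norm_sq_of_inner_eq_zero _ _ h2
  rw [perp, sub_add_cancel] at h3
  rw [perp]
  nlinarith [norm_nonneg x, norm_nonneg (x - (⟪e 1, x⟫ : ℝ) • e 1),
    norm_nonneg ((⟪e 1, x⟫ : ℝ) • e 1)]

lemma norm_le_abs_add_norm_perp (x : H) : ‖x‖ ≤ |(⟪e 1, x⟫ : ℝ)| + ‖perp e x‖ := by
  have : x = (⟪e 1, x⟫ : ℝ) • e 1 + perp e x := by rw [perp]; abel
  calc ‖x‖ = ‖(⟪e 1, x⟫ : ℝ) • e 1 + perp e x‖ := by rw [← this]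
    _ ≤ _ := by
      refine (norm_add_le _ _).trans_eq ?_
      rw [norm_smul, norm_basis, mul_one, Real.norm_eq_abs]

/-- The map of the tube onto a neighborhood of the broken line. -/
def tubeMap (T : ℤ → H ≃ₗᵢ[ℝ] H) (x : H) : H := bend e T ⟪e 1, x⟫ ((1 / 10 : ℝ) • perp e x)

variable {e} {T : ℤ → H ≃ₗᵢ[ℝ] H} {r : ℝ}

lemma inner_smul_perp (x : H) : ⟪e 1, (1 / 10 : ℝ) • perp e x⟫ = 0 := by
  rw [inner_smul_right, inner_perp, mul_zero]

/-- The factor `1/10` in `tubeMap` serves to bring normal vectors within the bound `1/100` under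
which `bend` is controlled. -/
lemma norm_smul_perp_le (hr : r ≤ 1 / 10) {x : H} (hx : x ∈ tube e r) :
    ‖(1 / 10 : ℝ) • perp e x‖ ≤ 1 / 100 := by
  have : ‖perp e x‖ < r := (mem_tube_iff_inner e).1 hx
  rw [norm_smul, Real.norm_of_nonneg (by norm_num)]
  linarith

lemma IsFrameSeq.norm_tubeMap_sub (hT : IsFrameSeq e T) (hr : r ≤ 1 / 10) {x y : H}
    (hy : y ∈ tube e r) (hxy : ‖x - y‖ ≤ 1 / 4) :
    ‖x - y‖ / 250 ≤ ‖tubeMap e T x - tubeMap e T y‖ ∧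
      ‖tubeMap e T x - tubeMap e T y‖ ≤ 250 * ‖x - y‖ := by
  obtain ⟨p1, p2⟩ := norm_perp_le e (x - y)
  have p3 := norm_le_abs_add_norm_perp e (x - y)
  have hs : ‖(1 / 10 : ℝ) • perp e x - (1 / 10 : ℝ) • perp e y‖ = ‖perp e (x - y)‖ / 10 := by
    rw [← smul_sub, ← perp_sub, norm_smul, Real.norm_of_nonneg (by norm_num)]
    ring
  rw [inner_sub_right] at p2 p3
  have hts := p2.trans hxy
  have u := norm_bend_sub_le (e := e) (T := T) (v := (1 / 10 : ℝ) • perp e x)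
    (hts.trans (by norm_num)) (norm_smul_perp_le hr hy)
  obtain ⟨l1, l2⟩ := hT.le_norm_bend_sub hts (inner_smul_perp x) (inner_smul_perp y)
    (norm_smul_perp_le hr hy)
  rw [hs] at u l2
  rw [tubeMap, tubeMap]
  constructor <;> linarith [norm_nonneg (x - y)]

lemma IsFrameSeq.injOn_tubeMap (hT : IsFrameSeq e T) (hr : r ≤ 1 / 10) :
    InjOn (tubeMap e T) (tube e r) := by
  intro x hx y hy h
  obtain ⟨h1, h2⟩ := hT.bend_injective (inner_smul_perp x) (inner_smul_perp y)
    (norm_smul_perp_le hr hx) (norm_smul_perp_le hr hy) h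
  have h3 := smul_right_injective H (by norm_num : (1 / 10 : ℝ) ≠ 0) h2
  rw [perp, perp, h1] at h3
  exact sub_left_injective h3

lemma IsFrameSeq.isOpen_image_tubeMap (hT : IsFrameSeq e T) (hr : r ≤ 1 / 10) {s : Set H}
    (hs : IsOpen s) (hsub : s ⊆ tube e r) : IsOpen (tubeMap e T '' s) := by
  rw [Metric.isOpen_iff]
  rintro _ ⟨x, hx, rfl⟩
  obtain ⟨ε, hε, hball⟩ := Metric.isOpen_iff.1 hs x hx
  -- The preimage moves by at most `5 + 10 * 24 = 245` times the displacement of `y`.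
  refine ⟨min (1 / 100) (ε / 250), by positivity, fun y hy => ?_⟩
  rw [mem_ball, dist_eq_norm, lt_min_iff] at hy
  obtain ⟨t, v, hv, hb, h1, h2⟩ := hT.exists_bend_eq (inner_smul_perp x)
    (norm_smul_perp_le hr (hsub hx)) hy.1
  have e1 : ⟪e 1, t • e 1 + (10 : ℝ) • v⟫ = t := by
    rw [inner_add_right, inner_smul_right, inner_smul_right, hv, inner_basis]
    simp
  have e2 : perp e (t • e 1 + (10 : ℝ) • v) = (10 : ℝ) • v := by
    rw [perp, e1, add_sub_cancel_left]
  refine ⟨t • e 1 + (10 : ℝ) • v, hball ?_, ?_⟩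
  · rw [mem_ball, dist_eq_norm]
    refine (norm_le_abs_add_norm_perp e _).trans_lt ?_
    rw [perp_sub, inner_sub_right, e1, e2]
    have e3 : ‖(10 : ℝ) • v - perp e x‖ = 10 * ‖v - (1 / 10 : ℝ) • perp e x‖ := by
      rw [show (10 : ℝ) • v - perp e x = (10 : ℝ) • (v - (1 / 10 : ℝ) • perp e x) by module,
        norm_smul, Real.norm_of_nonneg (by norm_num)]
    rw [e3]
    have h1' : |t - ⟪e 1, x⟫| ≤ 5 * ‖y - tubeMap e T x‖ := h1
    have h2' : ‖v - (1 / 10 : ℝ) • perp e x‖ ≤ 24 * ‖y - tubeMap e T x‖ := h2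
    linarith [norm_nonneg (y - tubeMap e T x)]
  · rw [tubeMap, e1, e2, smul_smul]
    norm_num
    exact hb

lemma image_tubeMap_axis : tubeMap e T '' axis e = brokenLine e := by
  have hax : ∀ t : ℝ, tubeMap e T (t • e 1) = interp e t := fun t => by
    have h1 : ⟪e 1, t • e 1⟫ = t := by rw [inner_smul_right, inner_basis]; simp
    rw [tubeMap, perp, h1, sub_self, smul_zero, bend]
    simp [interp]
  have hseg : ∀ (n : ℤ) (θ : ℝ), (1 - θ) • e n + θ • e (n + 1)
      = e n + (((n : ℝ) + θ) - n) • (e (n + 1) - e n) := fun n θ => by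
    rw [add_sub_cancel_left]; module
  ext y
  simp only [axis, brokenLine, mem_iUnion, ← range_comp, mem_range, Function.comp_apply, hax,
    segment_eq_image, mem_image]
  constructor
  · rintro ⟨t, rfl⟩
    -- The segments are indexed by their right endpoint, the cells by their left one.
    refine ⟨⌊t⌋ + 1, t - ⌊t⌋, ⟨Int.fract_nonneg t, (Int.fract_lt_one t).le⟩, ?_⟩
    rw [add_sub_cancel_right, interp_eq _ (Int.floor_le t) (Int.lt_floor_add_one t).le]
    module
  · rintro ⟨j, θ, hθ, rfl⟩
    refine ⟨((j - 1 : ℤ) : ℝ) + θ, ?_⟩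
    rw [interp_eq _ (le_add_of_nonneg_right hθ.1) (by linarith [hθ.2]), ← hseg, sub_add_cancel]

/-- A tube about a line in Hilbert space is locally bilipschitz equivalent to a bounded
neighborhood of the broken line. -/
theorem exists_isLocBilip_tube [CompleteSpace H] (e : HilbertBasis ℤ ℝ H) (hr : r ≤ 1 / 10) :
    ∃ (M : ℝ) (f : OpenPartialHomeomorph H H), 1 ≤ M ∧ IsLocBilip M f ∧
      f.source = tube e r ∧ f '' axis e = brokenLine e ∧ f.target ⊆ ball 0 2 := by
  obtain ⟨T, hT⟩ := exists_isFrameSeq e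
  have hcont : ContinuousOn (tubeMap e T) (tube e r) := by
    intro x hx
    refine ContinuousAt.continuousWithinAt ?_
    rw [ContinuousAt, tendsto_iff_norm_sub_tendsto_zero]
    have hc : Tendsto (fun y => 250 * ‖y - x‖) (𝓝 x) (𝓝 0) := by
      have : Continuous fun y => 250 * ‖y - x‖ := by fun_prop
      simpa using this.tendsto x
    refine squeeze_zero' (Eventually.of_forall fun _ => norm_nonneg _) ?_ hc
    filter_upwards [ball_mem_nhds x (by norm_num : (0 : ℝ) < 1 / 4)] with y hy
    exact (hT.norm_tubeMap_sub hr hx (mem_ball_iff_norm.1 hy).le).2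
  have hrestr : IsOpenMap ((tube e r).domRestrict (tubeMap e T)) := by
    intro s hs
    rw [Set.domRestrict_eq, image_comp]
    exact hT.isOpen_image_tubeMap hr ((isOpen_tube e r).isOpenMap_subtype_val s hs)
      (by rintro _ ⟨x, -, rfl⟩; exact x.2)
  set f := OpenPartialHomeomorph.ofContinuousOpenRestrict
    ((hT.injOn_tubeMap hr).toPartialEquiv (tubeMap e T) (tube e r)) hcont hrestr (isOpen_tube e r)
    with hf
  have hsrc : f.source = tube e r := rfl
  have hcoe : ⇑f = tubeMap e T := rfl
  refine ⟨250, f, by norm_num, fun x hx => ?_, hsrc, ?_, ?_⟩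
  · refine ⟨ball x (1 / 8) ∩ tube e r, Filter.inter_mem (ball_mem_nhds x (by norm_num))
      ((isOpen_tube e r).mem_nhds hx), inter_subset_right, fun y hy z hz => ?_⟩
    rw [hcoe]
    refine hT.norm_tubeMap_sub hr hz.2 ?_
    have := dist_triangle_right y z x
    rw [dist_eq_norm] at this
    linarith [mem_ball.1 hy.1, mem_ball.1 hz.1]
  · rw [hcoe, image_tubeMap_axis]
  · rw [← f.image_source_eq_target]
    rintro _ ⟨x, hx, rfl⟩
    rw [hcoe, mem_ball, dist_zero_right, tubeMap, bend]
    refine (norm_add_le _ _).trans_lt ?_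
    have h1 := norm_interp_le (fun n => (norm_basis e n).le) ⟪e 1, x⟫
    have h2 := norm_frame_le T ⟪e 1, x⟫ ((1 / 10 : ℝ) • perp e x)
    have h3 := norm_smul_perp_le hr hx
    linarith

end TubeMap

/-! ### Assembly of the theorem. -/

lemma IsSlitMap.isFQC_and_isQH {f : OpenPartialHomeomorph ℂ ℂ} (hf : IsSlitMap f) :
    IsFQC (linearGrowth 32 (by norm_num)) f ∧ IsQH 32 f :=
  isFQC_and_isQH_of_univalent hf.2.2 (hf.1 ▸ isDom_ball) (hf.1 ▸ ball_ne_univ)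
    (hf.2.1 ▸ slitDisk_ne_univ)

lemma two_le_rank_complex : 2 ≤ Module.rank ℝ ℂ := Complex.rank_real_complex.ge

end FreeQC

end

theorem theorem1p3 :
    -- an FQC homeomorphism need not satisfy the distance ratio inequality on all subdomains
    (¬ ∀ (E E' : Type) [NormedAddCommGroup E] [NormedSpace ℝ E] [CompleteSpace E]
        [NormedAddCommGroup E'] [NormedSpace ℝ E'] [CompleteSpace E']
        (f : OpenPartialHomeomorph E E'),
        2 ≤ Module.rank ℝ E → 2 ≤ Module.rank ℝ E' →
        FreeQC.IsDom f.source → f.source ≠ Set.univ →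
        FreeQC.IsDom f.target → f.target ≠ Set.univ →
        (∃ φ₁ : ℝ≥0 ≃ₜ ℝ≥0, FreeQC.IsGrowth φ₁ ∧ FreeQC.IsFQC φ₁ f) →
        ∃ φ : ℝ≥0 ≃ₜ ℝ≥0, FreeQC.IsGrowth φ ∧
          ∀ D₁ : Set E, FreeQC.IsDom D₁ → D₁ ⊆ f.source → FreeQC.JIneqOn φ f D₁) ∧
    -- a quasihyperbolic homeomorphism need not satisfy it on `D` with a linear function
    (¬ ∀ (E E' : Type) [NormedAddCommGroup E] [NormedSpace ℝ E] [CompleteSpace E]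
        [NormedAddCommGroup E'] [NormedSpace ℝ E'] [CompleteSpace E']
        (f : OpenPartialHomeomorph E E'),
        2 ≤ Module.rank ℝ E → 2 ≤ Module.rank ℝ E' →
        FreeQC.IsDom f.source → f.source ≠ Set.univ →
        FreeQC.IsDom f.target → f.target ≠ Set.univ →
        (∃ M₁ : ℝ, 1 < M₁ ∧ FreeQC.IsQH M₁ f) →
        ∃ (M : ℝ) (φ : ℝ≥0 ≃ₜ ℝ≥0), 1 ≤ M ∧ (∀ t : ℝ≥0, (φ t : ℝ) = M * t) ∧
          FreeQC.JIneqOn φ f f.source) ∧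
    -- the conformal maps of the unit disk onto the slit disk
    (∃ f : OpenPartialHomeomorph ℂ ℂ, FreeQC.IsSlitMap f) ∧
    (∃ M : ℝ, 1 < M ∧ ∀ f : OpenPartialHomeomorph ℂ ℂ, FreeQC.IsSlitMap f →
      FreeQC.IsQH M f ∧
      (∃ φ₁ : ℝ≥0 ≃ₜ ℝ≥0, FreeQC.IsGrowth φ₁ ∧ (∀ t : ℝ≥0, (φ₁ t : ℝ) = M * t) ∧
        FreeQC.IsFQC φ₁ f) ∧
      ∀ φ : ℝ≥0 ≃ₜ ℝ≥0,
        ¬ FreeQC.JIneqOn φ f (Metric.ball 0 1) ∧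
        ¬ FreeQC.JIneqOn φ f (Metric.ball 0 1 \ {f.symm (-1 / 2)})) ∧
    -- the maps of a tube about a line onto a neighborhood of the broken line in Hilbert space
    (∀ (H : Type*) [NormedAddCommGroup H] [InnerProductSpace ℝ H] [CompleteSpace H]
      (e : HilbertBasis ℤ ℝ H) (r : ℝ), 0 < r → r ≤ 1 / 10 →
      (∃ (M : ℝ) (f : OpenPartialHomeomorph H H), 1 ≤ M ∧ FreeQC.IsLocBilip M f ∧
        f.source = FreeQC.tube e r ∧ f '' FreeQC.axis e = FreeQC.brokenLine e ∧
        f.target ⊆ Metric.ball 0 2) ∧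
      ∀ (M : ℝ) (f : OpenPartialHomeomorph H H), 1 ≤ M → FreeQC.IsLocBilip M f →
        f.source = FreeQC.tube e r → FreeQC.brokenLine e ⊆ f.target →
        Bornology.IsBounded f.target →
        FreeQC.IsQH (M ^ 2) f ∧
        (∃ φ₁ : ℝ≥0 ≃ₜ ℝ≥0, FreeQC.IsGrowth φ₁ ∧
          (∀ t : ℝ≥0, (φ₁ t : ℝ) = M ^ 2 * t) ∧ FreeQC.IsFQC φ₁ f) ∧
        ∀ φ : ℝ≥0 ≃ₜ ℝ≥0, ¬ FreeQC.JIneqOn φ f (FreeQC.tube e r)) := by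
  refine ⟨fun h => ?_, fun h => ?_, FreeQC.exists_isSlitMap, ⟨32, by norm_num, fun f hf =>
    ⟨hf.isFQC_and_isQH.2, ⟨FreeQC.linearGrowth 32 (by norm_num),
      FreeQC.isGrowth_linearGrowth _, FreeQC.linearGrowth_apply _, hf.isFQC_and_isQH.1⟩,
      fun φ => ⟨hf.not_jIneqOn_ball φ, hf.not_jIneqOn_punctured φ⟩⟩⟩,
    fun H _ _ _ e r hr hr' => ⟨FreeQC.exists_isLocBilip_tube e hr',
      fun M f hM hf hsrc _ hbdd => ?_⟩⟩
  -- The slit map, with the whole disk as subdomain, refutes both converses.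
  · obtain ⟨f, hf⟩ := FreeQC.exists_isSlitMap
    obtain ⟨φ, -, hφ⟩ := h ℂ ℂ f FreeQC.two_le_rank_complex FreeQC.two_le_rank_complex
      (hf.1 ▸ FreeQC.isDom_ball) (hf.1 ▸ FreeQC.ball_ne_univ) (hf.2.1 ▸ hf.isDom_slitDisk)
      (hf.2.1 ▸ FreeQC.slitDisk_ne_univ)
      ⟨_, FreeQC.isGrowth_linearGrowth _, hf.isFQC_and_isQH.1⟩
    exact hf.not_jIneqOn_ball φ (hφ _ FreeQC.isDom_ball hf.1.ge)
  · obtain ⟨f, hf⟩ := FreeQC.exists_isSlitMap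
    obtain ⟨-, φ, -, -, hφ⟩ := h ℂ ℂ f FreeQC.two_le_rank_complex FreeQC.two_le_rank_complex
      (hf.1 ▸ FreeQC.isDom_ball) (hf.1 ▸ FreeQC.ball_ne_univ) (hf.2.1 ▸ hf.isDom_slitDisk)
      (hf.2.1 ▸ FreeQC.slitDisk_ne_univ) ⟨32, by norm_num, hf.isFQC_and_isQH.2⟩
    exact hf.not_jIneqOn_ball φ (hf.1 ▸ hφ)
  · obtain ⟨h1, h2⟩ := hf.isFQC_and_isQH hM (hsrc ▸ FreeQC.isDom_tube e hr)
      (hsrc ▸ FreeQC.tube_ne_univ e hr) (FreeQC.ne_univ_of_isBounded e hbdd)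
    exact ⟨h2, ⟨_, FreeQC.isGrowth_linearGrowth _, FreeQC.linearGrowth_apply _, h1⟩,
      hf.not_jIneqOn_tube e hM hr hsrc hbdd⟩
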